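/- Let $\&$ be a continuous t-norm on $[0,1]$ (a commutative, associative, order-preserving, jointly continuous operation $[0,1]^2\to[0,1]$ with unit $1$), with implication $x\rightarrow y=\max\{z\in[0,1] : x\& z\le y\}$. **Conventions.** A *real-enriched category* is a set $X$ with a map $X(-,-)\colon X\times X\to[0,1]$ such that $X(x,x)=1$ and $X(y,z)\& X(x,y)\le X(x,z)$. A *functor* $f\colon X\to Y$ is a map with $X(x,y)\le Y(f(x),f(y))$; $f\colon X\to Y$ is *left adjoint* to $g\colon Y\to X$ (and $g$ is a *right adjoint*), written $f\dashv g$, if $Y(f(x),y)=X(x,g(y))$ for all $x,y$. Real-enriched categories and functors form the category $[0,1]\text{-}\mathbf{Cat}$. Let ${\sf V}$ be $[0,1]$ with ${\sf V}(x,y)=x\rightarrow y$. A *weight* of $X$ is a map $\phi\colon X\to[0,1]$ with $\phi(y)\& X(x,y)\le\phi(x)$; a *coweight* is a map $\psi\colon X\to[0,1]$ with $X(x,y)\&\psi(x)\le\psi(y)$. Put ${\rm sub}_X(\lambda,\mu)=\inf_{x\in X}(\lambda(x)\rightarrow\mu(x))$. The weights form the real-enriched category $\mathcal PX$ with $\mathcal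 PX(\phi_1,\phi_2)={\rm sub}_X(\phi_1,\phi_2)$, and the coweights form $\mathcal P^\dagger X$ with $\mathcal P^\dagger X(\psi_1,\psi_2)={\rm sub}_X(\psi_2,\psi_1)$. Write ${\sf y}(a)=X(-,a)$ and ${\sf y}^\dagger(a)=X(a,-)$. A *colimit* of a weight $\phi$ is an element $b$ with $X(b,x)=\mathcal PX(\phi,{\sf y}(x))$ for all $x$; a *limit* of a coweight $\psi$ is an element $b$ with $X(x,b)=\mathcal P^\dagger X({\sf y}^\dagger(x),\psi)$ for all $x$. For a functor $f\colon X\to Y$ put $\mathcal P f(\phi)(y)=\sup_{x}\phi(x)\& Y(y,f(x))$ and $\mathcal P^\dagger f(\psi)(y)=\sup_{x}Y(f(x),y)\&\psi(x)$. A colimit of $h\colon K\to X$ weighted by a weight $\phi$ of $K$ is a colimit of $\mathcal P h(\phi)$. A functor *preserves finite colimits* if it preserves all existing weighted colimits of functors $h\colon K\to X$ with $K$ having finitely many objects. A weight $\phi$ of $X$ is an *ideal* if the functor ${\rm sub}_X(\phi,-)\colon\mathcal PX\to{\sf V}$ preserves finite colimits; $\mathcal IX\subseteq\mathcal PX$ is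 the full subcategory of ideals, and $\mathcal JX\subseteq\mathcal IX$ that of the ideals having a colimit. The *presheaf monad* $\mathbb P=(\mathcal P,{\sf m},{\sf y})$ on $[0,1]\text{-}\mathbf{Cat}$ has ${\sf m}_X\colon\mathcal P\mathcal PX\to\mathcal PX$ sending each weight to its colimit, i.e. ${\sf m}_X(\Phi)(x)=\Phi({\sf y}(x))$; the *ideal monad* $\mathbb I=(\mathcal I,{\sf m},{\sf y})$ is its submonad of ideals; the *copresheaf monad* $\mathbb P^\dagger=(\mathcal P^\dagger,{\sf m}^\dagger,{\sf y}^\dagger)$ has ${\sf m}^\dagger_X$ sending each coweight of $\mathcal P^\dagger X$ to its limit, i.e. ${\sf m}^\dagger_X(\Psi)(x)=\Psi({\sf y}^\dagger(x))$. The monad $\mathbb P^\dagger$ *distributes over* $\mathbb I$ if there is a distributive law in the sense of Beck, that is, a natural transformation $\delta\colon\mathcal P^\dagger\mathcal I\to\mathcal I\mathcal P^\dagger$ compatible with the units and the multiplications of both monads. A real-enriched category $X$ is *completely distributive* (a real-enriched completely distributive lattice) if it carries a $\mathbb P$-algebra structure and there are functors with $d\dashv\operatorname{colim}\dashv{\sf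 y}\colon X\to\mathcal PX$. A net $(x_i)_{i\in D}$ in $X$ is *forward Cauchy* if $\sup_{i}\inf_{k\ge j\ge i}X(x_j,x_k)=1$, and $b$ is a *Yoneda limit* of it if $X(b,y)=\sup_i\inf_{j\ge i}X(x_j,y)$ for all $y\in X$. A *real-enriched domain* is a real-enriched category $X$ in which every forward Cauchy net has a unique Yoneda limit and for which there are functors with $d\dashv\operatorname{colim}\dashv{\sf y}\colon X\to\mathcal JX$. **Theorem.** The following are equivalent: 1. Every completely distributive real-enriched category is a real-enriched domain. 2. The real-enriched category ${\sf V}$ is a real-enriched domain. 3. The implication $\rightarrow\colon[0,1]^2\to[0,1]$ is continuous at every point $(x,y)$ with $x\ne y$. 4. For each (Eilenberg–Moore) $\mathbb P^\dagger$-algebra $X$, the inclusion $\mathcal IX\to\mathcal PX$ is a right adjoint. 5. The copresheaf monad $\mathbb P^\dagger$ distributes over the ideal monad $\mathbb I$. -/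

import Mathlib

open CategoryTheory

universe u v w

namespace RealEnriched

noncomputable section

/-! ### Continuous t-norms and their implication -/

/-- A continuous t-norm on the unit interval. -/
structure ContTNorm where
  mul : unitInterval → unitInterval → unitInterval
  comm : ∀ x y, mul x y = mul y x
  assoc : ∀ x y z, mul (mul x y) z = mul x (mul y z)
  mono : ∀ x y z, y ≤ z → mul x y ≤ mul x z
  mul_one : ∀ x, mul x 1 = x
  continuous : Continuous fun p : unitInterval × unitInterval => mul p.1 p.2

namespace ContTNorm

variable (t : ContTNorm)

/-- The implication (residuum) `x → y`: the largest `z` with `x & z ≤ y`,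
see `ContTNorm.mul_le_iff`. -/
def imp (x y : unitInterval) : unitInterval := sSup {z | t.mul x z ≤ y}

instance : Std.Commutative t.mul := ⟨t.comm⟩

instance : Std.Associative t.mul := ⟨t.assoc⟩

theorem one_mul (x : unitInterval) : t.mul 1 x = x := by rw [t.comm, t.mul_one]

theorem mul_mono {a b c d : unitInterval} (h : a ≤ b) (h' : c ≤ d) : t.mul a c ≤ t.mul b d :=
  (t.mono a c d h').trans (by rw [t.comm a, t.comm b]; exact t.mono d a b h)

theorem mul_zero (x : unitInterval) : t.mul x 0 = 0 :=
  le_antisymm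
    ((t.mul_mono (le_top : x ≤ 1) (le_refl (0 : unitInterval))).trans (t.one_mul 0).le)
    bot_le

theorem mul_le_iff {x y z : unitInterval} : t.mul x z ≤ y ↔ z ≤ t.imp x y := by
  refine ⟨fun h => le_sSup h, fun h => ?_⟩
  have hc : IsClosed {z | t.mul x z ≤ y} :=
    isClosed_le (t.continuous.comp (by fun_prop : Continuous fun z => (x, z))) continuous_const
  have hne : {z | t.mul x z ≤ y}.Nonempty := ⟨0, by simp [t.mul_zero]⟩
  have hm : t.mul x (t.imp x y) ≤ y := hc.csSup_mem hne (OrderTop.bddAbove _)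
  exact (t.mono _ _ _ h).trans hm

theorem gc (x : unitInterval) : GaloisConnection (t.mul x) (t.imp x) :=
  fun _ _ => t.mul_le_iff

theorem mul_iSup {ι : Sort v} (x : unitInterval) (f : ι → unitInterval) :
    t.mul x (⨆ i, f i) = ⨆ i, t.mul x (f i) := (t.gc x).l_iSup

theorem iSup_mul {ι : Sort v} (x : unitInterval) (f : ι → unitInterval) :
    t.mul (⨆ i, f i) x = ⨆ i, t.mul (f i) x := by
  rw [t.comm, mul_iSup]; simp only [t.comm x]

theorem mul_imp_le (x y : unitInterval) : t.mul x (t.imp x y) ≤ y :=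
  t.mul_le_iff.2 le_rfl

theorem imp_mul (x y z : unitInterval) : t.imp (t.mul x y) z = t.imp x (t.imp y z) := by
  refine eq_of_forall_le_iff fun c => ?_
  rw [← t.mul_le_iff, ← t.mul_le_iff, ← t.mul_le_iff]
  rw [show t.mul (t.mul x y) c = t.mul y (t.mul x c) by ac_rfl]

theorem imp_iSup {ι : Sort v} (f : ι → unitInterval) (z : unitInterval) :
    t.imp (⨆ i, f i) z = ⨅ i, t.imp (f i) z := by
  refine eq_of_forall_le_iff fun c => ?_
  simp only [← t.mul_le_iff, iSup_mul, iSup_le_iff, le_iInf_iff]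

theorem imp_iInf {ι : Sort v} (x : unitInterval) (f : ι → unitInterval) :
    t.imp x (⨅ i, f i) = ⨅ i, t.imp x (f i) := (t.gc x).u_iInf

theorem one_imp (x : unitInterval) : t.imp 1 x = x := by
  refine eq_of_forall_le_iff fun c => ?_
  rw [← t.mul_le_iff, t.one_mul]

theorem imp_eq_one {x y : unitInterval} : t.imp x y = 1 ↔ x ≤ y := by
  have : t.imp x y = 1 ↔ 1 ≤ t.imp x y := ⟨fun h => h.ge, fun h => le_antisymm le_top h⟩
  rw [this, ← t.mul_le_iff, t.mul_one]

theorem imp_mono {x x' y y' : unitInterval} (h : x' ≤ x) (h' : y ≤ y') :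
    t.imp x y ≤ t.imp x' y' :=
  t.mul_le_iff.1 (((t.mul_mono h le_rfl).trans (t.mul_imp_le x y)).trans h')

theorem imp_trans (x y z : unitInterval) :
    t.mul (t.imp y z) (t.imp x y) ≤ t.imp x z := by
  rw [← t.mul_le_iff, show t.mul x (t.mul (t.imp y z) (t.imp x y))
    = t.mul (t.mul x (t.imp x y)) (t.imp y z) by ac_rfl]
  exact (t.mul_mono (t.mul_imp_le _ _) le_rfl).trans (t.mul_imp_le _ _)

theorem imp_left_injective {a b : unitInterval} (h : ∀ z, t.imp a z = t.imp b z) : a = b :=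
  le_antisymm (t.imp_eq_one.1 ((h b).trans (t.imp_eq_one.2 le_rfl)))
    (t.imp_eq_one.1 ((h a).symm.trans (t.imp_eq_one.2 le_rfl)))

end ContTNorm

/-! ### Real-enriched categories, functors, adjunctions -/

/-- A real-enriched category (for the continuous t-norm `t`). -/
structure RCat (t : ContTNorm) : Type (u + 1) where
  carrier : Type u
  hom : carrier → carrier → unitInterval
  hom_self : ∀ x, hom x x = 1
  hom_trans : ∀ x y z, t.mul (hom y z) (hom x y) ≤ hom x z

instance (t : ContTNorm) : CoeSort (RCat.{u} t) (Type u) := ⟨RCat.carrier⟩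

/-- A functor of real-enriched categories. -/
@[ext]
structure RFunctor {t : ContTNorm} (X : RCat.{u} t) (Y : RCat.{v} t) : Type (max u v) where
  toFun : X → Y
  hom_le : ∀ x y, X.hom x y ≤ Y.hom (toFun x) (toFun y)

instance {t : ContTNorm} (X : RCat.{u} t) (Y : RCat.{v} t) :
    CoeFun (RFunctor X Y) (fun _ => X → Y) := ⟨RFunctor.toFun⟩

/-- The category of real-enriched categories and functors. -/
instance (t : ContTNorm) : Category (RCat.{u} t) where
  Hom X Y := RFunctor X Y
  id X := ⟨fun x => x, fun _ _ => le_rfl⟩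
  comp f g := ⟨fun x => g (f x), fun x y => (f.hom_le x y).trans (g.hom_le _ _)⟩

section

variable {t : ContTNorm}

/-- The composite of two functors. -/
def RFunctor.comp {X : RCat.{u} t} {Y : RCat.{v} t} {Z : RCat.{w} t}
    (g : RFunctor Y Z) (f : RFunctor X Y) : RFunctor X Z :=
  ⟨fun x => g (f x), fun x y => (f.hom_le x y).trans (g.hom_le _ _)⟩

/-- `f` is left adjoint to `g`. -/
def Adj {X : RCat.{u} t} {Y : RCat.{v} t} (f : RFunctor X Y) (g : RFunctor Y X) : Prop :=
  ∀ x y, Y.hom (f x) y = X.hom x (g y)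

/-- `g` is a right adjoint. -/
def IsRightAdjoint {X : RCat.{u} t} {Y : RCat.{v} t} (g : RFunctor Y X) : Prop :=
  ∃ f : RFunctor X Y, Adj f g

/-- The full subcategory on the elements satisfying `p`. -/
abbrev subcat (X : RCat.{u} t) (p : X → Prop) : RCat.{u} t where
  carrier := {x : X // p x}
  hom x y := X.hom x.1 y.1
  hom_self x := X.hom_self x.1
  hom_trans x y z := X.hom_trans x.1 y.1 z.1

/-- The inclusion functor of a full subcategory. -/
def subcatIncl (X : RCat.{u} t) (p : X → Prop) : RFunctor (subcat X p) X :=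
  ⟨Subtype.val, fun _ _ => le_rfl⟩

variable (t) in
/-- The real-enriched category `V`: the unit interval with `V(x, y) = x → y`. -/
abbrev V : RCat.{0} t where
  carrier := unitInterval
  hom := t.imp
  hom_self _ := t.imp_eq_one.2 le_rfl
  hom_trans := t.imp_trans

/-- The inclusion degree `sub(a, b) = inf_x (a x → b x)` of fuzzy subsets. -/
def sub (t : ContTNorm) {A : Type u} (a b : A → unitInterval) : unitInterval :=
  ⨅ x, t.imp (a x) (b x)

theorem le_sub {A : Type u} {a b : A → unitInterval} {r : unitInterval} :
    r ≤ sub t a b ↔ ∀ x, t.mul (a x) r ≤ b x := by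
  simp only [sub, le_iInf_iff, t.mul_le_iff]

theorem mul_sub_le {A : Type u} (a b : A → unitInterval) (x : A) :
    t.mul (a x) (sub t a b) ≤ b x := le_sub.1 le_rfl x

theorem sub_self {A : Type u} (a : A → unitInterval) : sub t a a = 1 :=
  le_antisymm le_top (le_sub.2 fun x => by rw [t.mul_one])

theorem sub_trans {A : Type u} (a b c : A → unitInterval) :
    t.mul (sub t b c) (sub t a b) ≤ sub t a c := by
  refine le_sub.2 fun x => ?_
  rw [show t.mul (a x) (t.mul (sub t b c) (sub t a b))
    = t.mul (t.mul (a x) (sub t a b)) (sub t b c) by ac_rfl]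
  exact (t.mul_mono (mul_sub_le a b x) le_rfl).trans (mul_sub_le b c x)

/-! ### Weights and coweights -/

/-- A weight of `X`: a distributor from `X` to the one-point category. -/
@[ext]
structure Weight (X : RCat.{u} t) : Type u where
  toFun : X → unitInterval
  mul_le : ∀ x y, t.mul (toFun y) (X.hom x y) ≤ toFun x

instance (X : RCat.{u} t) : CoeFun (Weight X) (fun _ => X → unitInterval) := ⟨Weight.toFun⟩

/-- A coweight of `X`: a distributor from the one-point category to `X`. -/
@[ext]
structure Coweight (X : RCat.{u} t) : Type u where
  toFun : X → unitInterval
  mul_le : ∀ x y, t.mul (X.hom x y) (toFun x) ≤ toFun y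

instance (X : RCat.{u} t) : CoeFun (Coweight X) (fun _ => X → unitInterval) := ⟨Coweight.toFun⟩

/-- The real-enriched category `𝒫X` of weights. -/
abbrev presheaf (X : RCat.{u} t) : RCat.{u} t where
  carrier := Weight X
  hom a b := sub t a b
  hom_self a := sub_self a
  hom_trans a b c := sub_trans a b c

/-- The real-enriched category `𝒫†X` of coweights; note the reversed order. -/
abbrev copresheaf (X : RCat.{u} t) : RCat.{u} t where
  carrier := Coweight X
  hom a b := sub t b a
  hom_self a := sub_self a
  hom_trans a b c := by rw [t.comm]; exact sub_trans c b a

/-- The representable weight `X(-, a)`. -/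
def yonedaWeight (X : RCat.{u} t) (a : X) : Weight X :=
  ⟨fun x => X.hom x a, fun x y => X.hom_trans x y a⟩

/-- The representable coweight `X(a, -)`. -/
def yonedaCoweight (X : RCat.{u} t) (a : X) : Coweight X :=
  ⟨fun x => X.hom a x, fun x y => X.hom_trans a x y⟩

theorem sub_yoneda {X : RCat.{u} t} (a : X) (φ : Weight X) :
    sub t (yonedaWeight X a) φ = φ a := by
  refine le_antisymm ?_ (le_sub.2 fun x => ?_)
  · have := mul_sub_le (t := t) (yonedaWeight X a) φ a
    rwa [show yonedaWeight X a a = 1 from X.hom_self a, t.one_mul] at this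
  · rw [t.comm]; exact φ.mul_le x a

theorem sub_coyoneda {X : RCat.{u} t} (a : X) (ψ : Coweight X) :
    sub t (yonedaCoweight X a) ψ = ψ a := by
  refine le_antisymm ?_ (le_sub.2 fun x => ?_)
  · have := mul_sub_le (t := t) (yonedaCoweight X a) ψ a
    rwa [show yonedaCoweight X a a = 1 from X.hom_self a, t.one_mul] at this
  · exact ψ.mul_le a x

/-- `f_∃ φ = φ ∘ f^*`, i.e. `f_∃ φ (y) = sup_x φ(x) & Y(y, f x)`. -/
def Weight.map {X : RCat.{u} t} {Y : RCat.{v} t} (f : RFunctor X Y) (φ : Weight X) : Weight Y where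
  toFun y := ⨆ x, t.mul (φ x) (Y.hom y (f x))
  mul_le y z := by
    rw [t.iSup_mul]
    refine iSup_mono fun x => ?_
    rw [t.assoc]
    exact t.mono _ _ _ (Y.hom_trans _ _ _)

/-- `f†_∃ ψ = f_* ∘ ψ`, i.e. `f†_∃ ψ (y) = sup_x Y(f x, y) & ψ(x)`. -/
def Coweight.map {X : RCat.{u} t} {Y : RCat.{v} t} (f : RFunctor X Y) (ψ : Coweight X) :
    Coweight Y where
  toFun y := ⨆ x, t.mul (Y.hom (f x) y) (ψ x)
  mul_le y z := by
    rw [t.mul_iSup]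
    refine iSup_mono fun x => ?_
    rw [← t.assoc]
    exact t.mul_mono (Y.hom_trans _ _ _) le_rfl

/-- `f⁻¹ γ = γ ∘ f_*`, which is `x ↦ γ (f x)`. -/
def Weight.comap {X : RCat.{u} t} {Y : RCat.{v} t} (f : RFunctor X Y) (γ : Weight Y) :
    Weight X where
  toFun x := γ (f x)
  mul_le x y := (t.mono _ _ _ (f.hom_le x y)).trans (γ.mul_le _ _)

/-- `f⁻¹ γ = f^* ∘ γ`, which is `x ↦ γ (f x)`. -/
def Coweight.comap {X : RCat.{u} t} {Y : RCat.{v} t} (f : RFunctor X Y) (γ : Coweight Y) :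
    Coweight X where
  toFun x := γ (f x)
  mul_le x y := (t.mul_mono (f.hom_le x y) le_rfl).trans (γ.mul_le _ _)

/-- `f_∃` is left adjoint to `f⁻¹`. -/
theorem sub_map {X : RCat.{u} t} {Y : RCat.{v} t} (f : RFunctor X Y) (φ : Weight X)
    (γ : Weight Y) : sub t (φ.map f) γ = sub t φ (γ.comap f) := by
  refine eq_of_forall_le_iff fun r => ?_
  rw [le_sub, le_sub]
  constructor
  · intro h x
    refine le_trans (t.mul_mono ?_ le_rfl) (h (f x))
    refine le_trans ?_ (le_iSup _ x)
    rw [Y.hom_self, t.mul_one]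
  · intro h y
    change t.mul (⨆ x, t.mul (φ x) (Y.hom y (f x))) r ≤ γ y
    rw [t.iSup_mul]
    refine iSup_le fun x => ?_
    rw [show t.mul (t.mul (φ x) (Y.hom y (f x))) r = t.mul (t.mul (φ x) r) (Y.hom y (f x)) by
      ac_rfl]
    exact (t.mul_mono (h x) le_rfl).trans (γ.mul_le _ _)

theorem Weight.map_id' {X : RCat.{u} t} (φ : Weight X) :
    φ.map (⟨fun x => x, fun _ _ => le_rfl⟩ : RFunctor X X) = φ := by
  ext y : 2
  refine le_antisymm (iSup_le fun x => φ.mul_le _ _) (le_trans ?_ (le_iSup _ y))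
  rw [X.hom_self, t.mul_one]

theorem Coweight.map_id' {X : RCat.{u} t} (φ : Coweight X) :
    φ.map (⟨fun x => x, fun _ _ => le_rfl⟩ : RFunctor X X) = φ := by
  ext y : 2
  refine le_antisymm (iSup_le fun x => φ.mul_le _ _) (le_trans ?_ (le_iSup _ y))
  rw [X.hom_self, t.one_mul]

theorem Weight.map_map {X : RCat.{u} t} {Y : RCat.{v} t} {Z : RCat.{w} t}
    (f : RFunctor X Y) (g : RFunctor Y Z) (φ : Weight X) :
    (φ.map f).map g = φ.map (g.comp f) := by
  ext z : 2
  refine le_antisymm (iSup_le fun y => ?_) (iSup_le fun x => ?_)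
  · change t.mul (⨆ x, t.mul (φ x) (Y.hom y (f x))) (Z.hom z (g y)) ≤ _
    rw [t.iSup_mul]
    refine iSup_le fun x => le_trans ?_ (le_iSup _ x)
    rw [t.assoc]
    exact t.mono _ _ _ ((t.mul_mono (g.hom_le _ _) le_rfl).trans (Z.hom_trans _ _ _))
  · refine le_trans ?_ (le_iSup _ (f x))
    refine t.mul_mono (le_trans ?_ (le_iSup _ x)) le_rfl
    rw [Y.hom_self, t.mul_one]

theorem Coweight.map_map {X : RCat.{u} t} {Y : RCat.{v} t} {Z : RCat.{w} t}
    (f : RFunctor X Y) (g : RFunctor Y Z) (ψ : Coweight X) :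
    (ψ.map f).map g = ψ.map (g.comp f) := by
  ext z : 2
  refine le_antisymm (iSup_le fun y => ?_) (iSup_le fun x => ?_)
  · change t.mul (Z.hom (g y) z) (⨆ x, t.mul (Y.hom (f x) y) (ψ x)) ≤ _
    rw [t.mul_iSup]
    refine iSup_le fun x => le_trans ?_ (le_iSup _ x)
    rw [← t.assoc]
    exact t.mul_mono ((t.mono _ _ _ (g.hom_le _ _)).trans (Z.hom_trans _ _ _)) le_rfl
  · refine le_trans ?_ (le_iSup _ (f x))
    refine t.mono _ _ _ (le_trans ?_ (le_iSup _ x))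
    rw [Y.hom_self, t.one_mul]

theorem Weight.hom_le_map {X : RCat.{u} t} {Y : RCat.{v} t} (f : RFunctor X Y)
    (φ ψ : Weight X) : sub t φ ψ ≤ sub t (φ.map f) (ψ.map f) := by
  refine le_sub.2 fun y => ?_
  change t.mul (⨆ x, t.mul (φ x) (Y.hom y (f x))) _ ≤ _
  rw [t.iSup_mul]
  refine iSup_le fun x => le_trans ?_ (le_iSup _ x)
  rw [show t.mul (t.mul (φ x) (Y.hom y (f x))) (sub t φ ψ)
    = t.mul (t.mul (φ x) (sub t φ ψ)) (Y.hom y (f x)) by ac_rfl]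
  exact t.mul_mono (mul_sub_le _ _ x) le_rfl

theorem Coweight.hom_le_map {X : RCat.{u} t} {Y : RCat.{v} t} (f : RFunctor X Y)
    (φ ψ : Coweight X) : sub t φ ψ ≤ sub t (φ.map f) (ψ.map f) := by
  refine le_sub.2 fun y => ?_
  change t.mul (⨆ x, t.mul (Y.hom (f x) y) (φ x)) _ ≤ _
  rw [t.iSup_mul]
  refine iSup_le fun x => le_trans ?_ (le_iSup _ x)
  rw [t.assoc]
  exact t.mono _ _ _ (mul_sub_le _ _ x)

theorem Weight.map_yoneda {X : RCat.{u} t} {Y : RCat.{v} t} (f : RFunctor X Y) (a : X) :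
    (yonedaWeight X a).map f = yonedaWeight Y (f a) := by
  ext y : 2
  refine le_antisymm (iSup_le fun x => ?_) (le_trans ?_ (le_iSup _ a))
  · exact (t.mul_mono (f.hom_le _ _) le_rfl).trans (Y.hom_trans _ _ _)
  · rw [show (yonedaWeight X a) a = 1 from X.hom_self a, t.one_mul]; exact le_rfl

theorem Coweight.map_yoneda {X : RCat.{u} t} {Y : RCat.{v} t} (f : RFunctor X Y) (a : X) :
    (yonedaCoweight X a).map f = yonedaCoweight Y (f a) := by
  ext y : 2
  refine le_antisymm (iSup_le fun x => ?_) (le_trans ?_ (le_iSup _ a))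
  · exact (t.mono _ _ _ (f.hom_le _ _)).trans (Y.hom_trans _ _ _)
  · rw [show (yonedaCoweight X a) a = 1 from X.hom_self a, t.mul_one]; exact le_rfl

/-! ### Colimits and limits -/

/-- `b` is a colimit of the weight `φ`: `X(b, x) = 𝒫X(φ, X(-, x))` for all `x`. -/
def IsColim {X : RCat.{u} t} (φ : Weight X) (b : X) : Prop :=
  ∀ x, X.hom b x = (presheaf X).hom φ (yonedaWeight X x)

/-- `b` is a limit of the coweight `ψ`: `X(x, b) = 𝒫†X(X(x, -), ψ)` for all `x`. -/
def IsLim {X : RCat.{u} t} (ψ : Coweight X) (b : X) : Prop :=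
  ∀ x, X.hom x b = (copresheaf X).hom (yonedaCoweight X x) ψ

/-- `b` is a colimit of the functor `f` weighted by `φ`. -/
def IsWeightedColim {K : RCat.{v} t} {X : RCat.{u} t} (φ : Weight K) (f : RFunctor K X) (b : X) :
    Prop :=
  IsColim (φ.map f) b

theorem isWeightedColim_iff {K : RCat.{v} t} {X : RCat.{u} t} (φ : Weight K) (f : RFunctor K X)
    (b : X) :
    IsWeightedColim φ f b ↔ ∀ x, X.hom b x = ⨅ k, t.imp (φ k) (X.hom (f k) x) :=
  forall_congr' fun x => by
    rw [show (presheaf X).hom (φ.map f) (yonedaWeight X x) = _ from sub_map f φ _]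
    rfl

/-- `f` preserves finite colimits: it preserves every existing colimit of a functor `h : K → X`
weighted by a weight `φ` of `K`, where `K` has finitely many objects. -/
def PreservesFiniteColims {X : RCat.{u} t} {Y : RCat.{v} t} (f : RFunctor X Y) : Prop :=
  ∀ (K : RCat.{0} t), Finite K → ∀ (φ : Weight K) (h : RFunctor K X) (b : X),
    IsWeightedColim φ h b → IsWeightedColim φ (f.comp h) (f b)

/-! ### Ideals -/

/-- The functor `sub_X(φ, -) : 𝒫X → V`. -/
def subFunctor {X : RCat.{u} t} (φ : Weight X) : RFunctor (presheaf X) (V t) where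
  toFun ψ := sub t φ ψ
  hom_le ψ ξ := by
    refine t.mul_le_iff.1 ?_
    rw [t.comm]
    exact sub_trans φ.toFun ψ.toFun ξ.toFun

/-- A weight `φ` is an ideal if `sub_X(φ, -) : 𝒫X → V` preserves finite colimits. -/
def IsIdeal {X : RCat.{u} t} (φ : Weight X) : Prop :=
  PreservesFiniteColims (subFunctor φ)

/-- The tensor `r & φ` in `𝒫X`. -/
def Weight.tensor {X : RCat.{u} t} (r : unitInterval) (φ : Weight X) : Weight X :=
  ⟨fun x => t.mul r (φ x), fun x y => by rw [t.assoc]; exact t.mono _ _ _ (φ.mul_le _ _)⟩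

/-- The pointwise supremum of a family of weights. -/
def Weight.sup {X : RCat.{u} t} {ι : Type v} (φ : ι → Weight X) : Weight X :=
  ⟨fun x => ⨆ i, φ i x, fun x y => by
    rw [t.iSup_mul]; exact iSup_mono fun i => (φ i).mul_le _ _⟩

/-- The pointwise maximum of two weights. -/
def Weight.max {X : RCat.{u} t} (φ ψ : Weight X) : Weight X :=
  ⟨fun x => φ x ⊔ ψ x, fun x y => by
    rw [t.comm, (t.gc _).l_sup, t.comm _ (φ y), t.comm _ (ψ y)]
    exact sup_le_sup (φ.mul_le _ _) (ψ.mul_le _ _)⟩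

theorem sub_iSup_left {A : Type u} {ι : Type v} (w : ι → unitInterval)
    (a : ι → A → unitInterval) (b : A → unitInterval) :
    sub t (fun x => ⨆ i, t.mul (w i) (a i x)) b = ⨅ i, t.imp (w i) (sub t (a i) b) := by
  simp only [sub, t.imp_iSup, t.imp_mul, t.imp_iInf]
  exact iInf_comm

theorem weight_eq_of_sub_eq {X : RCat.{u} t} {φ ψ : Weight X}
    (h : ∀ ξ : Weight X, sub t φ ξ = sub t ψ ξ) : φ = ψ := by
  ext x : 2
  refine le_antisymm ?_ ?_
  · have := mul_sub_le (t := t) φ.toFun ψ.toFun x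
    rwa [h ψ, sub_self, t.mul_one] at this
  · have := mul_sub_le (t := t) ψ.toFun φ.toFun x
    rwa [← h φ, sub_self, t.mul_one] at this

theorem isIdeal_of {X : RCat.{u} t} (φ : Weight X)
    (h₁ : ∀ (r : unitInterval) (ψ : Weight X),
      sub t φ (ψ.tensor r) = t.mul r (sub t φ ψ))
    (h₂ : ∀ ψ ξ : Weight X, sub t φ (ψ.max ξ) = sub t φ ψ ⊔ sub t φ ξ) : IsIdeal φ := by
  intro K hK w h b hb
  rw [isWeightedColim_iff] at hb ⊢
  have hb' : b = Weight.sup fun k => Weight.tensor (w k) (h k) := by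
    refine weight_eq_of_sub_eq fun ξ => (hb ξ).trans ?_
    exact (sub_iSup_left (t := t) (fun k => w k) (fun k => (h k).toFun) ξ.toFun).symm
  have key : ∀ s : Finset K, sub t φ (Weight.sup fun k : s => Weight.tensor (w k) (h k))
      = ⨆ k : s, t.mul (w k) (sub t φ (h k)) := by
    classical
    intro s
    induction s using Finset.induction_on with
    | empty =>
      have h0 := h₁ 0 (Weight.sup fun k : (∅ : Finset K) => Weight.tensor (w k) (h k))
      rw [t.comm, t.mul_zero] at h0
      rw [iSup_of_empty]
      refine Eq.trans (congrArg (sub t φ.toFun) ?_) h0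
      funext x
      change (⨆ k : (∅ : Finset K), _) = t.mul 0 _
      rw [iSup_of_empty, t.comm, t.mul_zero]
      rfl
    | insert a s ha ih =>
      have e : ∀ g : K → unitInterval,
          (⨆ k : (insert a s : Finset K), g k) = g a ⊔ ⨆ k : s, g k := by
        intro g
        simp [iSup_subtype, iSup_or, iSup_sup_eq]
      rw [e (fun k => t.mul (w k) (sub t φ (h k))), ← ih, ← h₁, ← h₂]
      congr 1
      funext x
      exact e (fun k => t.mul (w k) (h k x))
  intro x
  change t.imp (sub t φ b) x = ⨅ k, t.imp (w k) (t.imp (sub t φ (h k)) x)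
  simp only [← t.imp_mul, ← t.imp_iSup]
  congr 1
  have : Fintype K := Fintype.ofFinite K
  have hu := key Finset.univ
  rw [iSup_subtype] at hu
  simp only [Finset.mem_univ, iSup_pos] at hu
  rw [← hu, hb']
  congr 1
  funext y
  change (⨆ k, t.mul (w k) (h k y)) = ⨆ k : (Finset.univ : Finset K), t.mul (w k) (h k y)
  rw [iSup_subtype (p := fun k => k ∈ (Finset.univ : Finset K))]
  simp

theorem IsIdeal.sub_tensor {X : RCat.{u} t} {φ : Weight X} (hφ : IsIdeal φ)
    (r : unitInterval) (ψ : Weight X) : sub t φ (ψ.tensor r) = t.mul r (sub t φ ψ) := by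
  let K : RCat.{0} t := ⟨Unit, fun _ _ => 1, fun _ => rfl, fun _ _ _ => by rw [t.mul_one]⟩
  have := hφ K (inferInstanceAs (Finite Unit)) ⟨fun _ => r, fun _ _ => by
    change t.mul r 1 ≤ r
    rw [t.mul_one]⟩
    ⟨fun _ => ψ, fun _ _ => (sub_self (t := t) ψ.toFun).ge⟩ (ψ.tensor r) (by
      rw [isWeightedColim_iff]
      intro ξ
      have := sub_iSup_left (t := t) (fun _ : Unit => r) (fun _ => ψ.toFun) ξ.toFun
      simp only [ciSup_const, ciInf_const] at this
      exact this.trans (ciInf_const (ι := Unit)).symm)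
  rw [isWeightedColim_iff] at this
  refine t.imp_left_injective fun z => (this z).trans ?_
  rw [t.imp_mul]
  exact ciInf_const (ι := Unit) (a := t.imp r (t.imp (sub t φ ψ) z))

theorem IsIdeal.sub_max {X : RCat.{u} t} {φ : Weight X} (hφ : IsIdeal φ)
    (ψ ξ : Weight X) : sub t φ (ψ.max ξ) = sub t φ ψ ⊔ sub t φ ξ := by
  let K : RCat.{0} t := ⟨Bool, fun a b => if a = b then 1 else 0, fun _ => by simp,
    fun a b c => by
      by_cases h : a = b <;> by_cases h' : b = c <;> simp_all [t.mul_one, t.mul_zero]⟩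
  have := hφ K (inferInstanceAs (Finite Bool)) ⟨fun _ => 1, fun _ _ => le_top⟩
    ⟨fun b => Bool.rec ψ ξ b, fun a b => by
      by_cases h : a = b
      · subst h; exact (RCat.hom_self _ _).ge.trans' le_top
      · exact (if_neg h).le.trans bot_le⟩ (ψ.max ξ) (by
      rw [isWeightedColim_iff]
      intro η
      have := sub_iSup_left (t := t) (fun _ : Bool => (1 : unitInterval))
        (fun b => Bool.rec ψ.toFun ξ.toFun b) η.toFun
      simp only [t.one_mul, iSup_bool_eq, t.one_imp, iInf_bool_eq] at this
      change sub t (fun x => ψ x ⊔ ξ x) η = ⨅ k : Bool, t.imp 1 (sub t (Weight.toFun _) η)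
      simp only [t.one_imp, iInf_bool_eq]
      rw [← this]
      congr 1
      funext x
      exact sup_comm _ _)
  rw [isWeightedColim_iff] at this
  refine t.imp_left_injective fun z => (this z).trans ?_
  change (⨅ k : Bool, t.imp 1 (t.imp (sub t φ (Weight.toFun _)) z)) = _
  simp only [t.one_imp, iInf_bool_eq]
  have e : sub t φ ψ ⊔ sub t φ ξ = ⨆ b : Bool, Bool.rec (sub t φ ψ) (sub t φ ξ) b := by
    rw [iSup_bool_eq, sup_comm]
  rw [e, t.imp_iSup, iInf_bool_eq]

theorem isIdeal_yoneda (X : RCat.{u} t) (a : X) : IsIdeal (yonedaWeight X a) :=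
  isIdeal_of _ (fun _ _ => by rw [sub_yoneda, sub_yoneda]; rfl)
    (fun _ _ => by rw [sub_yoneda, sub_yoneda, sub_yoneda]; rfl)

theorem IsIdeal.map {X : RCat.{u} t} {Y : RCat.{v} t} (f : RFunctor X Y) {φ : Weight X}
    (hφ : IsIdeal φ) : IsIdeal (φ.map f) :=
  isIdeal_of _ (fun r ψ => by rw [sub_map, sub_map]; exact hφ.sub_tensor r (ψ.comap f))
    (fun ψ ξ => by
      rw [sub_map, sub_map, sub_map]; exact hφ.sub_max (ψ.comap f) (ξ.comap f))

/-! ### Saturated classes of weights and their monads -/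

/-- The Yoneda embedding with codomain restricted to a full subcategory of weights that contains
the representable ones. -/
def yonedaRestr (X : RCat.{u} t) (p : Weight X → Prop) (hp : ∀ a, p (yonedaWeight X a)) :
    RFunctor X (subcat (presheaf X) p) where
  toFun a := ⟨yonedaWeight X a, hp a⟩
  hom_le a b := (sub_yoneda a (yonedaWeight X b)).ge

/-- For a class of weights `p` of `X` that contains the representable ones and a weight `Φ` of the
category of these, the weight `Φ ∘ y_*` is the colimit in `𝒫X` of the inclusion weighted by `Φ`. -/
theorem isWeightedColim_comap_yoneda (X : RCat.{u} t) (p : Weight X → Prop)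
    (hp : ∀ a, p (yonedaWeight X a)) (Φ : Weight (subcat (presheaf X) p)) :
    IsWeightedColim Φ (subcatIncl (presheaf X) p) (Φ.comap (yonedaRestr X p hp)) := by
  rw [isWeightedColim_iff]
  intro ξ
  refine eq_of_forall_le_iff fun r => ?_
  refine le_sub.trans ?_
  rw [le_iInf_iff]
  constructor
  · intro h φ
    rw [← t.mul_le_iff]
    refine le_sub.2 fun x => ?_
    refine le_trans ?_ (h x)
    rw [← t.assoc]
    refine t.mul_mono ?_ le_rfl
    rw [t.comm]
    refine le_trans (t.mono _ _ _ ?_) (Φ.mul_le (yonedaRestr X p hp x) φ)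
    exact (sub_yoneda x φ.1).ge
  · intro h x
    rw [t.mul_le_iff, ← sub_yoneda x ξ]
    exact h (yonedaRestr X p hp x)

/-- A saturated class of weights: a class of weights containing the representable ones, stable
under the functors `f_∃`, and closed under the multiplication of the presheaf monad. -/
structure SaturatedClass (t : ContTNorm) where
  mem : ∀ X : RCat.{u} t, Weight X → Prop
  yoneda_mem : ∀ (X : RCat.{u} t) (a : X), mem X (yonedaWeight X a)
  map_mem : ∀ {X Y : RCat.{u} t} (f : RFunctor X Y) (φ : Weight X), mem X φ → mem Y (φ.map f)
  mul_mem : ∀ (X : RCat.{u} t) (Φ : Weight (subcat (presheaf X) (mem X))),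
    mem _ Φ → mem X (Φ.comap (yonedaRestr X (mem X) (yoneda_mem X)))

namespace SaturatedClass

variable (S : SaturatedClass.{u} t)

/-- The real-enriched category `𝒯X`. -/
abbrev obj (X : RCat.{u} t) : RCat.{u} t := subcat (presheaf X) (S.mem X)

/-- The inclusion `𝒯X → 𝒫X`. -/
def incl (X : RCat.{u} t) : RFunctor (S.obj X) (presheaf X) := subcatIncl _ _

/-- The Yoneda embedding `X → 𝒯X`. -/
def yoneda (X : RCat.{u} t) : RFunctor X (S.obj X) := yonedaRestr X (S.mem X) (S.yoneda_mem X)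

/-- The functor `f_∃ : 𝒯X → 𝒯Y`. -/
def map {X Y : RCat.{u} t} (f : RFunctor X Y) : RFunctor (S.obj X) (S.obj Y) where
  toFun φ := ⟨φ.1.map f, S.map_mem f φ.1 φ.2⟩
  hom_le φ ψ := Weight.hom_le_map f φ.1 ψ.1

/-- The multiplication `𝒯𝒯X → 𝒯X`, sending `Φ` to the colimit in `𝒫X` of the inclusion
weighted by `Φ`. -/
def mult (X : RCat.{u} t) : RFunctor (S.obj (S.obj X)) (S.obj X) where
  toFun Φ := ⟨Φ.1.comap (S.yoneda X), S.mul_mem X Φ.1 Φ.2⟩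
  hom_le Φ Ψ := le_sub.2 fun x => mul_sub_le Φ.1.toFun Ψ.1.toFun (S.yoneda X x)

theorem hom_yoneda (X : RCat.{u} t) (x : X) (φ : S.obj X) :
    (S.obj X).hom (S.yoneda X x) φ = φ.1 x := sub_yoneda x φ.1

theorem map_yoneda {X Y : RCat.{u} t} (f : RFunctor X Y) (x : X) :
    S.map f (S.yoneda X x) = S.yoneda Y (f x) := Subtype.ext (Weight.map_yoneda f x)

theorem mult_map {X Y : RCat.{u} t} (f : RFunctor X Y) (Φ : S.obj (S.obj X)) :
    S.mult Y (S.map (S.map f) Φ) = S.map f (S.mult X Φ) := by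
  refine Subtype.ext (Weight.ext (funext fun y => ?_))
  change (⨆ φ, t.mul (Φ.1 φ) ((S.obj Y).hom (S.yoneda Y y) (S.map f φ)))
    = ⨆ x, t.mul (Φ.1 (S.yoneda X x)) (Y.hom y (f x))
  refine le_antisymm (iSup_le fun φ => ?_) (iSup_le fun x => ?_)
  · rw [hom_yoneda]
    change t.mul _ (⨆ x, t.mul (φ.1 x) (Y.hom y (f x))) ≤ _
    rw [t.mul_iSup]
    refine iSup_mono fun x => ?_
    rw [← t.assoc, ← S.hom_yoneda X x φ]
    exact t.mul_mono (Φ.1.mul_le _ _) le_rfl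
  · refine le_trans ?_ (le_iSup _ (S.yoneda X x))
    rw [map_yoneda, hom_yoneda]
    exact le_rfl

/-- The monad on real-enriched categories given by a saturated class of weights. -/
def monad : Monad (RCat.{u} t) where
  obj := S.obj
  map f := S.map f
  map_id X := RFunctor.ext (funext fun φ => Subtype.ext (Weight.map_id' φ.1))
  map_comp f g := RFunctor.ext (funext fun φ => Subtype.ext (Weight.map_map f g φ.1).symm)
  η := {
    app := fun X => S.yoneda X
    naturality := fun _ _ f => RFunctor.ext (funext fun x => (S.map_yoneda f x).symm) }
  μ := {
    app := fun X => S.mult X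
    naturality := fun _ _ f => RFunctor.ext (funext fun Φ => S.mult_map f Φ) }
  assoc X := RFunctor.ext (funext fun Φ => Subtype.ext (Weight.ext (funext fun x => by
    change (⨆ Ψ, t.mul (Φ.1 Ψ) ((S.obj X).hom (S.yoneda X x) (S.mult X Ψ)))
      = Φ.1 (S.yoneda (S.obj X) (S.yoneda X x))
    refine le_antisymm (iSup_le fun Ψ => ?_)
      (le_trans ?_ (le_iSup _ (S.yoneda (S.obj X) (S.yoneda X x))))
    · rw [hom_yoneda]
      change t.mul (Φ.1 Ψ) (Ψ.1 (S.yoneda X x)) ≤ _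
      rw [← S.hom_yoneda (S.obj X) (S.yoneda X x) Ψ]
      exact Φ.1.mul_le _ _
    · rw [hom_yoneda]
      change _ ≤ t.mul _ ((S.obj X).hom (S.yoneda X x) (S.yoneda X x))
      rw [RCat.hom_self, t.mul_one])))
  left_unit X := RFunctor.ext (funext fun φ => Subtype.ext (Weight.ext (funext fun x =>
    S.hom_yoneda X x φ)))
  right_unit X := RFunctor.ext (funext fun φ => Subtype.ext (Weight.ext (funext fun x => by
    change (⨆ z, t.mul (φ.1 z) ((S.obj X).hom (S.yoneda X x) (S.yoneda X z))) = φ.1 x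
    refine Eq.trans (iSup_congr fun z => ?_)
      (congrFun (congrArg Weight.toFun (Weight.map_id' φ.1)) x)
    rw [S.hom_yoneda X x (S.yoneda X z)]
    rfl)))

/-- `X` carries the structure of an Eilenberg-Moore algebra of the monad. -/
def IsAlgebra (X : RCat.{u} t) : Prop := ∃ A : S.monad.Algebra, A.A = X

/-- `X` is a continuous algebra: an algebra with a string of adjunctions `d ⊣ colim ⊣ y`. -/
def IsContinuousAlgebra (X : RCat.{u} t) : Prop :=
  S.IsAlgebra X ∧ ∃ (d : RFunctor X (S.obj X)) (colim : RFunctor (S.obj X) X),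
    Adj d colim ∧ Adj colim (S.yoneda X)

end SaturatedClass

variable (t) in
/-- The class of all weights; its monad is the presheaf monad. -/
def allWeights : SaturatedClass.{u} t where
  mem _ _ := True
  yoneda_mem _ _ := trivial
  map_mem _ _ _ := trivial
  mul_mem _ _ _ := trivial

variable (t) in
/-- The class of ideals; its monad is the ideal monad. -/
def ideals : SaturatedClass.{u} t where
  mem _ φ := IsIdeal φ
  yoneda_mem X a := isIdeal_yoneda X a
  map_mem f _ h := h.map f
  mul_mem X Φ hΦ := by
    let ev : Weight X → Weight (subcat (presheaf X) (fun φ => IsIdeal φ)) := fun ψ =>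
      ⟨fun φ => sub t φ.1 ψ, fun φ φ' => sub_trans φ.1.toFun φ'.1.toFun ψ.toFun⟩
    have key : ∀ ψ : Weight X,
        sub t (Φ.comap (yonedaRestr X (fun φ => IsIdeal φ) (isIdeal_yoneda X))) ψ
          = sub t Φ (ev ψ) := fun ψ =>
      (isWeightedColim_iff _ _ _).1
        (isWeightedColim_comap_yoneda X (fun φ => IsIdeal φ) (isIdeal_yoneda X) Φ) ψ
    refine isIdeal_of _ (fun r ψ => ?_) (fun ψ ξ => ?_)
    · rw [key, key, ← hΦ.sub_tensor]
      congr 1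
      funext φ
      exact φ.2.sub_tensor r ψ
    · rw [key, key, key, ← hΦ.sub_max]
      congr 1
      funext φ
      exact φ.2.sub_max ψ ξ

variable (t) in
/-- The ideal monad `(ℐ, m, y)`. -/
def idealMonad : Monad (RCat.{u} t) := (ideals t).monad

/-! ### The copresheaf monad -/

/-- The coYoneda embedding `X → 𝒫†X`. -/
def coyoneda (X : RCat.{u} t) : RFunctor X (copresheaf X) where
  toFun a := yonedaCoweight X a
  hom_le a b := (sub_coyoneda b (yonedaCoweight X a)).ge

/-- The functor `f†_∃ : 𝒫†X → 𝒫†Y`. -/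
def copresheafMap {X Y : RCat.{u} t} (f : RFunctor X Y) :
    RFunctor (copresheaf X) (copresheaf Y) where
  toFun ψ := ψ.map f
  hom_le φ ψ := Coweight.hom_le_map f ψ φ

/-- The multiplication `𝒫†𝒫†X → 𝒫†X`, sending each coweight of `𝒫†X` to its limit,
see `isLim_copresheafMult`. -/
def copresheafMult (X : RCat.{u} t) : RFunctor (copresheaf (copresheaf X)) (copresheaf X) where
  toFun Ψ := Ψ.comap (coyoneda X)
  hom_le Φ Ψ := le_sub.2 fun x => mul_sub_le Ψ.toFun Φ.toFun (coyoneda X x)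

theorem hom_coyoneda (X : RCat.{u} t) (x : X) (ψ : copresheaf X) :
    (copresheaf X).hom ψ (coyoneda X x) = ψ.toFun x := sub_coyoneda x ψ

theorem isLim_copresheafMult (X : RCat.{u} t) (Ψ : Coweight (copresheaf X)) :
    IsLim Ψ (copresheafMult X Ψ) := by
  intro ξ
  refine eq_of_forall_le_iff fun r => ?_
  refine le_sub.trans (Iff.trans ?_ le_sub.symm)
  constructor
  · intro h ψ
    refine le_sub.2 fun x => ?_
    refine le_trans ?_ (h x)
    rw [← t.assoc]
    refine t.mul_mono ?_ le_rfl
    rw [← hom_coyoneda]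
    exact Ψ.mul_le ψ (coyoneda X x)
  · intro h x
    refine (h (coyoneda X x)).trans ?_
    exact (hom_coyoneda X x ξ).le

theorem copresheafMap_coyoneda {X Y : RCat.{u} t} (f : RFunctor X Y) (x : X) :
    copresheafMap f (coyoneda X x) = coyoneda Y (f x) := Coweight.map_yoneda f x

theorem copresheafMult_map {X Y : RCat.{u} t} (f : RFunctor X Y)
    (Φ : copresheaf (copresheaf X)) :
    copresheafMult Y (copresheafMap (copresheafMap f) Φ)
      = copresheafMap f (copresheafMult X Φ) := by
  refine Coweight.ext (funext fun y => ?_)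
  change (⨆ φ, t.mul ((copresheaf Y).hom (copresheafMap f φ) (coyoneda Y y)) (Φ.toFun φ))
    = ⨆ x, t.mul (Y.hom (f x) y) (Φ.toFun (coyoneda X x))
  refine le_antisymm (iSup_le fun φ => ?_) (iSup_le fun x => ?_)
  · rw [hom_coyoneda]
    change t.mul (⨆ x, t.mul (Y.hom (f x) y) (φ.toFun x)) _ ≤ _
    rw [t.iSup_mul]
    refine iSup_mono fun x => ?_
    rw [t.assoc, ← hom_coyoneda]
    exact t.mono _ _ _ (Φ.mul_le _ _)
  · refine le_trans ?_ (le_iSup _ (coyoneda X x))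
    rw [copresheafMap_coyoneda, hom_coyoneda]
    exact le_rfl

variable (t) in
/-- The copresheaf monad `(𝒫†, m†, y†)`. -/
def copresheafMonad : Monad (RCat.{u} t) where
  obj := copresheaf
  map f := copresheafMap f
  map_id X := RFunctor.ext (funext fun φ => Coweight.map_id' φ)
  map_comp f g := RFunctor.ext (funext fun φ => (Coweight.map_map f g φ).symm)
  η := {
    app := fun X => coyoneda X
    naturality := fun _ _ f => RFunctor.ext (funext fun x => (copresheafMap_coyoneda f x).symm) }
  μ := {
    app := fun X => copresheafMult X
    naturality := fun _ _ f => RFunctor.ext (funext fun Φ => copresheafMult_map f Φ) }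
  assoc X := RFunctor.ext (funext fun Φ => Coweight.ext (funext fun x => by
    change (⨆ Ψ, t.mul ((copresheaf X).hom (copresheafMult X Ψ) (coyoneda X x)) (Φ.toFun Ψ))
      = Φ.toFun (coyoneda (copresheaf X) (coyoneda X x))
    refine le_antisymm (iSup_le fun Ψ => ?_)
      (le_trans ?_ (le_iSup _ (coyoneda (copresheaf X) (coyoneda X x))))
    · rw [hom_coyoneda]
      change t.mul (Ψ.toFun (coyoneda X x)) (Φ.toFun Ψ) ≤ _
      rw [← hom_coyoneda]
      exact Φ.mul_le _ _
    · rw [hom_coyoneda]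
      change _ ≤ t.mul ((copresheaf X).hom (coyoneda X x) (coyoneda X x)) _
      rw [RCat.hom_self, t.one_mul]))
  left_unit X := RFunctor.ext (funext fun φ => Coweight.ext (funext fun x =>
    hom_coyoneda X x φ))
  right_unit X := RFunctor.ext (funext fun φ => Coweight.ext (funext fun x => by
    change (⨆ z, t.mul ((copresheaf X).hom (coyoneda X z) (coyoneda X x)) (φ.toFun z))
      = φ.toFun x
    refine Eq.trans (iSup_congr fun z => ?_)
      (congrFun (congrArg Coweight.toFun (Coweight.map_id' φ)) x)
    rw [hom_coyoneda X x (coyoneda X z)]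
    rfl))

/-! ### Completely distributive categories and real-enriched domains -/

/-- `X` is completely distributive: a continuous algebra of the presheaf monad. -/
def IsCompletelyDistributive (X : RCat.{u} t) : Prop := (allWeights t).IsContinuousAlgebra X

/-- A net is forward Cauchy if `sup_i inf_{k ≥ j ≥ i} X(x_j, x_k) = 1`. -/
def IsForwardCauchy {X : RCat.{u} t} {D : Type v} [Preorder D] (x : D → X) : Prop :=
  (⨆ i : D, ⨅ (j : D) (_ : i ≤ j) (k : D) (_ : j ≤ k), X.hom (x j) (x k)) = 1

/-- `b` is a Yoneda limit of a net if `X(b, y) = sup_i inf_{j ≥ i} X(x_j, y)` for all `y`. -/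
def IsYonedaLimit {X : RCat.{u} t} {D : Type v} [Preorder D] (x : D → X) (b : X) : Prop :=
  ∀ y, X.hom b y = ⨆ i : D, ⨅ (j : D) (_ : i ≤ j), X.hom (x j) y

/-- Every forward Cauchy net has a unique Yoneda limit. -/
def IsYonedaComplete (X : RCat.{u} t) : Prop :=
  ∀ (D : Type u) [Preorder D] [IsDirectedOrder D] [Nonempty D] (x : D → X),
    IsForwardCauchy x → ∃! b, IsYonedaLimit x b

theorem isColim_yoneda (X : RCat.{u} t) (a : X) : IsColim (yonedaWeight X a) a :=
  fun x => (sub_yoneda a (yonedaWeight X x)).symm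

/-- The category `𝒥X` of those ideals of `X` that have a colimit. -/
abbrev idealsWithColim (X : RCat.{u} t) : RCat.{u} t :=
  subcat (presheaf X) (fun φ => IsIdeal φ ∧ ∃ b, IsColim φ b)

/-- The Yoneda embedding `X → 𝒥X`. -/
def yonedaJ (X : RCat.{u} t) : RFunctor X (idealsWithColim X) :=
  yonedaRestr X _ (fun a => ⟨isIdeal_yoneda X a, a, isColim_yoneda X a⟩)

/-- `X` is continuous: there is a string of adjunctions `d ⊣ colim ⊣ y : X → 𝒥X`. -/
def IsContinuousCat (X : RCat.{u} t) : Prop :=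
  ∃ (d : RFunctor X (idealsWithColim X)) (colim : RFunctor (idealsWithColim X) X),
    Adj d colim ∧ Adj colim (yonedaJ X)

/-- A real-enriched domain: Yoneda complete and continuous. -/
def IsRealEnrichedDomain (X : RCat.{u} t) : Prop := IsYonedaComplete X ∧ IsContinuousCat X

end

/-! ### Distributive laws -/

/-- A distributive law (in the sense of Beck) of the monad `S` over the monad `M`: a natural
transformation `S M → M S` (first `M`, then `S`, to first `S`, then `M`) compatible with the units
and multiplications of both monads. -/
structure DistributiveLaw {C : Type u} [Category.{v} C] (S M : Monad C) where
  law : M.toFunctor ⋙ S.toFunctor ⟶ S.toFunctor ⋙ M.toFunctor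
  unit_left : ∀ X, S.η.app (M.obj X) ≫ law.app X = M.map (S.η.app X)
  unit_right : ∀ X, S.map (M.η.app X) ≫ law.app X = M.η.app (S.obj X)
  mul_left : ∀ X, S.μ.app (M.obj X) ≫ law.app X
    = S.map (law.app X) ≫ law.app (S.obj X) ≫ M.map (S.μ.app X)
  mul_right : ∀ X, S.map (M.μ.app X) ≫ law.app X
    = law.app (M.obj X) ≫ M.map (law.app X) ≫ M.μ.app (S.obj X)

/-- `S` distributes over `M`. -/
def Distributes {C : Type u} [Category.{v} C] (S M : Monad C) : Prop :=
  Nonempty (DistributiveLaw S M)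

end

end RealEnriched

/-! The hinge of all implications is whether cotensors `s → φ` of ideals are again ideals.

Continuity of `&` makes `→` upper semicontinuous, and below the diagonal it also controls the first
argument (`exists_gt_le_imp`). What remains of condition 3 is left continuity of `x → -` at `y` for
`0 < y < x` (`ImpLeftContinuous`).

Truth values form a chain, so an ideal below the maximum of two weights lies below one of them. In a
category with an initial object, binary joins and tensors, ideals are thereby characterized by three
conditions: value 1 at initial objects, `φ x ⊓ φ y ≤ φ (x ∨ y)`, and `φ (c ⊗ x) = 1` whenever `c < φ
x` (`isIdeal_of_apply`). These conditions pass to all infima; they pass to cotensors under left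
continuity (`isIdeal_cotensor`). Ideals are then closed under weighted limits, hence reflective in
the weights. The reflection gives 4, since a copresheaf algebra has all limits and the finite
colimits in question are limits of suitable coweights. Composed with the left adjoint `d` of a
completely distributive category it gives 1 and 2. For 5, the law sends a coweight of ideals to a
limit of ideals of `𝒫†X`.

Conversely, `V` is the test case. For `0 < y` the weight `z ↦ sup_{y' < y} (z → y')` is an ideal
with colimit `y`, and an ideal of `V` whose value at 1 exceeds `z` has value 1 at `z`. Continuity of
`V`, or stability of its ideals under cotensors, then forces `x → y ≤ sup_{y' < y} (z → y')` for all
`z < x`, and this inequality yields 3 (`continuousAt_imp_of_iSup`). -/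

namespace RealEnriched

noncomputable section

/-! ### Divisibility of the t-norm and one-sided continuity of the implication -/

namespace ContTNorm

variable (t : ContTNorm)

theorem mul_le_left (x y : unitInterval) : t.mul x y ≤ x :=
  (t.mono x y 1 le_top).trans (t.mul_one x).le

theorem mul_le_right (x y : unitInterval) : t.mul x y ≤ y := by
  rw [t.comm]; exact t.mul_le_left y x

theorem le_imp (x y : unitInterval) : y ≤ t.imp x y := t.mul_le_iff.1 (t.mul_le_right x y)

theorem continuous_mul_left (x : unitInterval) : Continuous fun z => t.mul x z :=
  t.continuous.comp (by fun_prop : Continuous fun z => (x, z))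

theorem continuous_mul_right (x : unitInterval) : Continuous fun z => t.mul z x :=
  t.continuous.comp (by fun_prop : Continuous fun z => (z, x))

/-- Divisibility: continuity of `&` makes `x & (x → y)` equal to `y` for `y ≤ x`. -/
theorem mul_imp_eq {x y : unitInterval} (h : y ≤ x) : t.mul x (t.imp x y) = y := by
  obtain ⟨z, hz⟩ : y ∈ Set.range fun z => t.mul x z :=
    mem_range_of_exists_le_of_exists_ge (t.continuous_mul_left x)
      ⟨0, by simp [t.mul_zero]⟩ ⟨1, by simpa [t.mul_one] using h⟩
  refine le_antisymm (t.mul_imp_le x y) ?_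
  have hz' : t.mul x z = y := hz
  conv_lhs => rw [← hz']
  exact t.mono _ _ _ (t.mul_le_iff.1 hz'.le)

theorem imp_le_imp_mul (a b c : unitInterval) :
    t.imp a b ≤ t.imp (t.mul c a) (t.mul c b) := by
  rw [← t.mul_le_iff, t.assoc]
  exact t.mono _ _ _ (t.mul_imp_le a b)

/-- The index must be nonempty: the empty infimum is 1, and `r & 1 = r`. -/
theorem mul_iInf {ι : Type*} [Nonempty ι] (r : unitInterval) (f : ι → unitInterval) :
    t.mul r (⨅ i, f i) = ⨅ i, t.mul r (f i) :=
  Monotone.map_ciInf_of_continuousAt (t.continuous_mul_left r).continuousAt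
    (fun a b h => t.mono r a b h) (OrderBot.bddBelow _)

/-- The implication is always upper semicontinuous. -/
theorem isClosed_le_imp : IsClosed {p : unitInterval × unitInterval × unitInterval |
    p.1 ≤ t.imp p.2.1 p.2.2} := by
  simp only [← t.mul_le_iff]
  exact isClosed_le (t.continuous.comp (by fun_prop :
    Continuous fun p : unitInterval × unitInterval × unitInterval => (p.2.1, p.1))) (by fun_prop)

theorem exists_gt_le_imp_self {r w : unitInterval} (hr : r < 1) (hw : t.mul r w < r) :
    ∃ u, r < u ∧ w ≤ t.imp u r := by
  have h : ∀ᶠ u in nhdsWithin r (Set.Ioi r), t.mul u w < r :=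
    nhdsWithin_le_nhds ((t.continuous_mul_right w).continuousAt.eventually_lt
      continuousAt_const hw)
  have hne : (nhdsWithin r (Set.Ioi r)).NeBot := nhdsGT_neBot_of_exists_gt ⟨1, hr⟩
  obtain ⟨u, hu, hru⟩ := (h.and self_mem_nhdsWithin).exists
  exact ⟨u, hru, t.mul_le_iff.1 hu.le⟩

/-- Below the diagonal, the implication is lower semicontinuous in its first argument. -/
theorem exists_gt_le_imp {x y c : unitInterval} (hyx : y < x) (hx : x < 1)
    (hc : c < t.imp x y) : ∃ x', x < x' ∧ c ≤ t.imp x' y := by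
  set r := t.imp x y with hr
  have hr1 : r < 1 := lt_of_le_of_ne le_top fun h => hyx.not_ge (t.imp_eq_one.1 h)
  -- Divisibility factors `c` as `r & w` with `w = r → c`. Then `x' & c = (x' & r) & w`, so it is
  -- enough to keep `x' & r` below `x & u` for some `u` with `(x & u) & w ≤ y`.
  have hrw : t.mul r (t.imp r c) = c := t.mul_imp_eq hc.le
  obtain ⟨u, hru, hu⟩ := t.exists_gt_le_imp_self (w := t.imp r c) hr1 (hrw.trans_lt hc)
  have hxr : t.mul x r = y := t.mul_imp_eq hyx.le
  have hxu : t.mul x r < t.mul x u := by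
    rw [hxr]
    exact not_le.1 fun h => hru.not_ge (t.mul_le_iff.1 h)
  have h : ∀ᶠ x' in nhdsWithin x (Set.Ioi x), t.mul x' r < t.mul x u :=
    nhdsWithin_le_nhds ((t.continuous_mul_right r).continuousAt.eventually_lt
      continuousAt_const hxu)
  have hne : (nhdsWithin x (Set.Ioi x)).NeBot := nhdsGT_neBot_of_exists_gt ⟨1, hx⟩
  obtain ⟨x', hx', hxx'⟩ := (h.and self_mem_nhdsWithin).exists
  refine ⟨x', hxx', t.mul_le_iff.1 ?_⟩
  have h1 : t.imp r c ≤ t.imp (t.mul x u) y := by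
    refine hu.trans ?_
    rw [← hxr]
    exact t.imp_le_imp_mul u r x
  rw [← hrw, ← t.assoc]
  exact (t.mul_mono hx'.le le_rfl).trans (t.mul_le_iff.2 h1)

/-- Upper semicontinuity is automatic, so only lower bounds near the point have to be supplied. -/
theorem continuousAt_imp_of {x y : unitInterval}
    (h : ∀ c < t.imp x y, ∀ᶠ p : unitInterval × unitInterval in nhds (x, y),
      c ≤ t.imp p.1 p.2) :
    ContinuousAt (fun p : unitInterval × unitInterval => t.imp p.1 p.2) (x, y) := by
  refine tendsto_order.2 ⟨fun a ha => ?_, fun a ha => ?_⟩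
  · obtain ⟨c, hac, hc⟩ := exists_between ha
    exact (h c hc).mono fun p hp => hac.trans_le hp
  · have hcl : IsClosed {p : unitInterval × unitInterval | a ≤ t.imp p.1 p.2} :=
      t.isClosed_le_imp.preimage (by fun_prop : Continuous fun p : unitInterval × unitInterval =>
        ((a, p) : unitInterval × unitInterval × unitInterval))
    have := hcl.isOpen_compl.mem_nhds (show (x, y) ∈ _ from not_le.2 ha)
    exact Filter.mem_of_superset this fun p hp => lt_of_not_ge (Set.notMem_ofPred_iff.1 hp)

theorem continuousAt_imp_of_lt {x y : unitInterval} (h : x < y) :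
    ContinuousAt (fun p : unitInterval × unitInterval => t.imp p.1 p.2) (x, y) := by
  refine t.continuousAt_imp_of fun c _ => ?_
  have : ∀ᶠ p : unitInterval × unitInterval in nhds (x, y), p.1 < p.2 :=
    continuousAt_fst.eventually_lt continuousAt_snd h
  exact this.mono fun p hp => le_top.trans (t.imp_eq_one.2 hp.le).ge

/-- A monotonicity criterion for continuity of the implication below the diagonal. -/
theorem continuousAt_imp_of_iSup (H : ∀ x y z : unitInterval, 0 < y → z < x →
    t.imp x y ≤ ⨆ y' : Set.Iio y, t.imp z y') {x y : unitInterval} (hxy : x ≠ y) :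
    ContinuousAt (fun p : unitInterval × unitInterval => t.imp p.1 p.2) (x, y) := by
  rcases hxy.lt_or_gt with h | hyx
  · exact t.continuousAt_imp_of_lt h
  refine t.continuousAt_imp_of fun c hc => ?_
  have hnear : ∀ z y' : unitInterval, c ≤ t.imp z y' → (∀ᶠ a in nhds x, a ≤ z) →
      (∀ᶠ b in nhds y, y' ≤ b) → ∀ᶠ p : unitInterval × unitInterval in nhds (x, y),
        c ≤ t.imp p.1 p.2 := by
    intro z y' h1 h2 h3
    filter_upwards [h2.prod_nhds h3] with p hp
    exact h1.trans (t.imp_mono hp.1 hp.2)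
  rcases eq_or_lt_of_le (show x ≤ 1 from le_top) with rfl | hx
  -- There is no room above `x = 1`, but `1 → -` is the identity, so `c` itself serves as the lower
  -- bound on the second argument.
  · rw [t.one_imp] at hc
    exact hnear 1 c (t.one_imp c).ge (Filter.Eventually.of_forall fun a => le_top)
      ((lt_mem_nhds hc).mono fun b hb => le_of_lt hb)
  · obtain ⟨c', hcc', hc'⟩ := exists_between hc
    obtain ⟨x', hxx', hx'⟩ := t.exists_gt_le_imp hyx hx hc'
    -- The point `z` bounds a neighbourhood of `x` from above and still lies strictly below `x'`, as
    -- required to apply `H` to `x'` and `z`.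
    obtain ⟨z, hxz, hzx'⟩ := exists_between hxx'
    have hz : ∀ᶠ a in nhds x, a ≤ z := (gt_mem_nhds hxz).mono fun a ha => le_of_lt ha
    rcases eq_or_lt_of_le (show 0 ≤ y from bot_le) with rfl | hy
    · exact hnear z 0 (hcc'.le.trans (hx'.trans (t.imp_mono hzx'.le le_rfl))) hz
        (Filter.Eventually.of_forall fun a => bot_le)
    · obtain ⟨y', hy'⟩ := lt_iSup_iff.1 (hcc'.trans_le (hx'.trans (H x' y z hy hzx')))
      exact hnear z y' hy'.le hz ((lt_mem_nhds y'.2).mono fun b hb => le_of_lt hb)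

/-- Left continuity of `x → (-)` below `x`, except at `0`. -/
def ImpLeftContinuous : Prop :=
  ∀ x y c : unitInterval, 0 < y → y < x → c < t.imp x y → ∃ y' < y, c ≤ t.imp x y'

theorem impLeftContinuous_of_continuousAt
    (h : ∀ x y : unitInterval, x ≠ y →
      ContinuousAt (fun p : unitInterval × unitInterval => t.imp p.1 p.2) (x, y)) :
    t.ImpLeftContinuous := by
  intro x y c hy hyx hc
  have hcont : ContinuousAt (fun b => t.imp x b) y :=
    (h x y hyx.ne').comp (f := fun b => (x, b)) (by fun_prop)
  have h1 : ∀ᶠ b in nhdsWithin y (Set.Iio y), c < t.imp x b :=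
    nhdsWithin_le_nhds (continuousAt_const.eventually_lt hcont hc)
  have hne : (nhdsWithin y (Set.Iio y)).NeBot := nhdsLT_neBot_of_exists_lt ⟨0, hy⟩
  obtain ⟨b, hb, hby⟩ := (h1.and self_mem_nhdsWithin).exists
  exact ⟨b, hby, hb.le⟩

end ContTNorm

/-! ### Auxiliary weights: constants, cotensors, infima and bounded weights -/

section

variable {t : ContTNorm}

theorem sub_eq_one {A : Type u} {a b : A → unitInterval} :
    sub t a b = 1 ↔ ∀ x, a x ≤ b x := by
  have : sub t a b = 1 ↔ 1 ≤ sub t a b := ⟨fun h => h.ge, fun h => le_antisymm le_top h⟩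
  rw [this, le_sub]
  simp only [t.mul_one]

theorem RCat.hom_mul_le (X : RCat.{u} t) (x y z : X) :
    t.mul (X.hom x y) (X.hom y z) ≤ X.hom x z := by
  rw [t.comm]; exact X.hom_trans x y z

/-- The constant weight. -/
def Weight.const (X : RCat.{u} t) (r : unitInterval) : Weight X :=
  ⟨fun _ => r, fun _ _ => t.mul_le_left _ _⟩

/-- The cotensor `r → φ` in `𝒫X`. -/
def Weight.cotensor {X : RCat.{u} t} (r : unitInterval) (φ : Weight X) : Weight X :=
  ⟨fun x => t.imp r (φ x), fun _ _ => by
    rw [← t.mul_le_iff, ← t.assoc]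
    exact (t.mul_mono (t.mul_imp_le _ _) le_rfl).trans (φ.mul_le _ _)⟩

/-- The pointwise infimum of a family of weights. -/
def Weight.inf {X : RCat.{u} t} {ι : Type v} (φ : ι → Weight X) : Weight X :=
  ⟨fun x => ⨅ i, φ i x, fun _ _ => le_iInf fun i =>
    (t.mul_mono (iInf_le _ i) le_rfl).trans ((φ i).mul_le _ _)⟩

/-- The weight `X(x, -) → q`, the largest one with value at most `q` at `x`. -/
def Weight.bounded (X : RCat.{u} t) (x : X) (q : unitInterval) : Weight X :=
  ⟨fun z => t.imp (X.hom x z) q, fun y z => by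
    rw [← t.mul_le_iff, t.comm (t.imp _ _), ← t.assoc]
    exact (t.mul_mono (X.hom_mul_le x y z) le_rfl).trans (t.mul_imp_le _ _)⟩

theorem Weight.le_of_le_bounded {X : RCat.{u} t} {φ : Weight X} {x : X} {q : unitInterval}
    (h : ∀ z, φ z ≤ Weight.bounded X x q z) : φ x ≤ q := by
  refine (h x).trans ?_
  change t.imp (X.hom x x) q ≤ q
  rw [X.hom_self, t.one_imp]

theorem Weight.le_bounded {X : RCat.{u} t} (φ : Weight X) (x : X) (z : X) :
    φ z ≤ Weight.bounded X x (φ x) z := by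
  refine t.mul_le_iff.1 ?_
  rw [t.comm]; exact φ.mul_le x z

theorem Weight.le_of_hom_eq_one {X : RCat.{u} t} (φ : Weight X) {x y : X}
    (h : X.hom x y = 1) : φ y ≤ φ x := by
  have := φ.mul_le x y
  rwa [h, t.mul_one] at this

/-! ### Finite colimits in a real-enriched category -/

/-- `b` is an initial object. -/
def IsInit {X : RCat.{u} t} (b : X) : Prop := ∀ w, X.hom b w = 1

/-- `b` is a binary join of `x` and `y`. -/
def IsJoin {X : RCat.{u} t} (x y b : X) : Prop := ∀ w, X.hom b w = X.hom x w ⊓ X.hom y w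

/-- `b` is the tensor of `r` and `x`. -/
def IsTensor {X : RCat.{u} t} (r : unitInterval) (x b : X) : Prop :=
  ∀ w, X.hom b w = t.imp r (X.hom x w)

/-- `X` has an initial object, binary joins and tensors. -/
structure FinCocomplete (X : RCat.{u} t) : Prop where
  init : ∃ b : X, IsInit b
  join : ∀ x y : X, ∃ b, IsJoin x y b
  tensor : ∀ (r : unitInterval) (x : X), ∃ b, IsTensor r x b

theorem IsJoin.hom_left {X : RCat.{u} t} {x y b : X} (h : IsJoin x y b) : X.hom x b = 1 :=
  le_antisymm le_top (((X.hom_self b).symm.trans (h b)).le.trans inf_le_left)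

theorem IsJoin.hom_right {X : RCat.{u} t} {x y b : X} (h : IsJoin x y b) : X.hom y b = 1 :=
  le_antisymm le_top (((X.hom_self b).symm.trans (h b)).le.trans inf_le_right)

theorem IsTensor.le_hom {X : RCat.{u} t} {r : unitInterval} {x b : X} (h : IsTensor r x b) :
    r ≤ X.hom x b := t.imp_eq_one.1 ((h b).symm.trans (X.hom_self b))

theorem IsTensor.imp_le_hom {X : RCat.{u} t} {r s : unitInterval} {x b c : X}
    (h : IsTensor r x b) (h' : IsTensor s x c) : t.imp r s ≤ X.hom b c := by
  rw [h c]; exact t.imp_mono le_rfl h'.le_hom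

/-! ### Ideals -/

/-- In a chain a maximum equal to 1 is attained by one of its two terms. -/
theorem IsIdeal.le_or_le {X : RCat.{u} t} {φ ψ ξ : Weight X} (hφ : IsIdeal φ)
    (h : ∀ x, φ x ≤ ψ x ⊔ ξ x) : (∀ x, φ x ≤ ψ x) ∨ ∀ x, φ x ≤ ξ x := by
  have h1 : sub t φ ψ ⊔ sub t φ ξ = 1 := by
    rw [← hφ.sub_max]; exact sub_eq_one.2 h
  rcases le_total (sub t φ ψ) (sub t φ ξ) with h2 | h2
  · right; rw [sup_eq_right.2 h2] at h1; exact sub_eq_one.1 h1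
  · left; rw [sup_eq_left.2 h2] at h1; exact sub_eq_one.1 h1

/-- Preservation of tensors, tested on the constant weight 1, makes the inclusion degree of `φ` in
the constant `q` equal to `q`. Hence the supremum of an ideal is 1. -/
theorem IsIdeal.eq_one_of_le {X : RCat.{u} t} {φ : Weight X} (hφ : IsIdeal φ) {q : unitInterval}
    (h : ∀ x, φ x ≤ q) : q = 1 := by
  have h1 := hφ.sub_tensor q (Weight.const X 1)
  have h2 : sub t φ (Weight.const X 1) = 1 := sub_eq_one.2 fun x => le_top
  rw [h2, t.mul_one] at h1
  rw [← h1]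
  refine sub_eq_one.2 fun x => (h x).trans ?_
  exact (t.mul_one q).ge

theorem IsIdeal.apply_init {X : RCat.{u} t} {φ : Weight X} (hφ : IsIdeal φ) {b : X}
    (hb : IsInit b) : φ b = 1 := hφ.eq_one_of_le fun x => φ.le_of_hom_eq_one (hb x)

/-- Implication turns the minimum in `X(b, -) = X(x, -) ⊓ X(y, -)` into a maximum, so irreducibility
applies to the weight bounding `φ` by its value at `b`. -/
theorem IsIdeal.apply_join {X : RCat.{u} t} {φ : Weight X} (hφ : IsIdeal φ) {x y b : X}
    (hb : IsJoin x y b) : φ x ⊓ φ y ≤ φ b := by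
  have := hφ.le_or_le (ψ := Weight.bounded X x (φ b)) (ξ := Weight.bounded X y (φ b)) fun z => by
    refine (φ.le_bounded b z).trans ?_
    change t.imp (X.hom b z) _ ≤ t.imp (X.hom x z) _ ⊔ t.imp (X.hom y z) _
    rw [hb z]
    rcases le_total (X.hom x z) (X.hom y z) with h | h
    · rw [inf_eq_left.2 h]; exact le_sup_left
    · rw [inf_eq_right.2 h]; exact le_sup_right
  rcases this with h | h
  · exact inf_le_left.trans (Weight.le_of_le_bounded h)
  · exact inf_le_right.trans (Weight.le_of_le_bounded h)

/-- Every `z` satisfies `c ≤ X(x, z)`, whence `φ z ≤ φ b`, or `X(x, z) ≤ c`, where the weight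
bounded by `c` at `x` is 1. Irreducibility selects one alternative globally; the second would give
`φ x ≤ c`. -/
theorem IsIdeal.apply_tensor {X : RCat.{u} t} {φ : Weight X} (hφ : IsIdeal φ) {c : unitInterval}
    {x b : X} (hb : IsTensor c x b) (hc : c < φ x) : φ b = 1 := by
  have := hφ.le_or_le (ψ := Weight.const X (φ b)) (ξ := Weight.bounded X x c) fun z => by
    rcases le_total c (X.hom x z) with h | h
    · refine le_trans (φ.le_of_hom_eq_one ?_) le_sup_left
      rw [hb z]; exact t.imp_eq_one.2 h
    · refine le_trans (le_top.trans (t.imp_eq_one.2 h).ge) le_sup_right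
  rcases this with h | h
  · exact hφ.eq_one_of_le h
  · exact absurd (Weight.le_of_le_bounded h) hc.not_ge

/-- A directed supremum of representable weights is an ideal. -/
theorem isIdeal_of_directed {X : RCat.{u} t} {ι : Type v} [Nonempty ι] (k : ι → X)
    (hk : ∀ i j, ∃ l, X.hom (k i) (k l) = 1 ∧ X.hom (k j) (k l) = 1) {φ : Weight X}
    (hφ : ∀ x, φ x = ⨆ i, X.hom x (k i)) : IsIdeal φ := by
  have hsub : ∀ ψ : Weight X, sub t φ ψ = ⨅ i, ψ (k i) := by
    intro ψ
    refine eq_of_forall_le_iff fun r => ?_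
    rw [le_sub, le_iInf_iff]
    constructor
    · intro h i
      have h1 := h (k i)
      have h2 : φ (k i) = 1 := le_antisymm le_top (by
        rw [hφ, ← X.hom_self (k i)]; exact le_iSup (fun j => X.hom (k i) (k j)) i)
      rwa [h2, t.one_mul] at h1
    · intro h x
      rw [hφ, t.iSup_mul]
      refine iSup_le fun i => (t.mono _ _ _ (h i)).trans ?_
      rw [t.comm]; exact ψ.mul_le x (k i)
  refine isIdeal_of φ (fun r ψ => ?_) (fun ψ ξ => ?_)
  · rw [hsub, hsub, t.mul_iInf]; rfl
  · rw [hsub, hsub, hsub]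
    refine le_antisymm ?_ (sup_le (iInf_mono fun i => le_sup_left) (iInf_mono fun i => le_sup_right))
    refine le_of_forall_gt fun a ha => ?_
    obtain ⟨ha1, ha2⟩ := sup_lt_iff.1 ha
    obtain ⟨i, hi⟩ := iInf_lt_iff.1 ha1
    obtain ⟨j, hj⟩ := iInf_lt_iff.1 ha2
    -- Weights reverse the order, so an upper bound `l` makes both values small simultaneously.
    obtain ⟨l, hil, hjl⟩ := hk i j
    refine (iInf_le _ l).trans_lt (sup_lt_iff.2 ⟨?_, ?_⟩)
    · exact (ψ.le_of_hom_eq_one hil).trans_lt hi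
    · exact (ξ.le_of_hom_eq_one hjl).trans_lt hj

/-- Ideals of a finitely cocomplete category are characterized by their behaviour on the initial
object, joins and tensors. -/
theorem isIdeal_of_apply {X : RCat.{u} t} (hX : FinCocomplete X) {φ : Weight X}
    (h₀ : ∀ b, IsInit b → φ b = 1) (h₁ : ∀ x y b, IsJoin x y b → φ x ⊓ φ y ≤ φ b)
    (h₂ : ∀ c x b, IsTensor c x b → c < φ x → φ b = 1) : IsIdeal φ := by
  obtain ⟨b₀, hb₀⟩ := hX.init
  -- The weight is recovered as the supremum of the representables at the objects where it equals 1.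
  -- Joins make this family directed, and the tensors `c' ⊗ x` with `c' < φ x` show that it reaches
  -- `φ x`.
  have : Nonempty {z : X // φ z = 1} := ⟨⟨b₀, h₀ b₀ hb₀⟩⟩
  refine isIdeal_of_directed (fun z : {z : X // φ z = 1} => z.1) (fun z z' => ?_) (fun x => ?_)
  · obtain ⟨b, hb⟩ := hX.join z.1 z'.1
    refine ⟨⟨b, le_antisymm le_top (le_trans ?_ (h₁ _ _ b hb))⟩, hb.hom_left, hb.hom_right⟩
    rw [z.2, z'.2, inf_idem]
  · refine le_antisymm (le_of_forall_lt fun c hc => ?_) (iSup_le fun z => ?_)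
    · obtain ⟨c', hcc', hc'⟩ := exists_between hc
      obtain ⟨b, hb⟩ := hX.tensor c' x
      exact hcc'.trans_le (hb.le_hom.trans (le_iSup (fun z : {z : X // φ z = 1} => X.hom x z.1)
        ⟨b, h₂ c' x b hb hc'⟩))
    · have := φ.mul_le x z.1
      rwa [z.2, t.one_mul] at this

/-! ### Limits of ideals and the reflection of weights into ideals -/

theorem isIdeal_inf {X : RCat.{u} t} (hX : FinCocomplete X) {ι : Type v} {φ : ι → Weight X}
    (hφ : ∀ i, IsIdeal (φ i)) : IsIdeal (Weight.inf φ) := by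
  refine isIdeal_of_apply hX (fun b hb => ?_) (fun x y b hb => ?_) (fun c x b hb hc => ?_)
  · exact le_antisymm le_top (le_iInf fun i => ((hφ i).apply_init hb).ge)
  · exact le_iInf fun i => (inf_le_inf (iInf_le _ i) (iInf_le _ i)).trans ((hφ i).apply_join hb)
  · exact le_antisymm le_top (le_iInf fun i =>
      ((hφ i).apply_tensor hb (hc.trans_le (iInf_le _ i))).ge)

/-- The ideal is 1 at `d ⊗ x`, and `c → d` bounds the hom from `c ⊗ x` to `d ⊗ x` from below. -/
theorem IsIdeal.imp_le_apply_tensor {X : RCat.{u} t} (hX : FinCocomplete X) {φ : Weight X}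
    (hφ : IsIdeal φ) {c d : unitInterval} {x b : X} (hb : IsTensor c x b) (hd : d < φ x) :
    t.imp c d ≤ φ b := by
  obtain ⟨b', hb'⟩ := hX.tensor d x
  have := φ.mul_le b b'
  rw [hφ.apply_tensor hb' hd, t.one_mul] at this
  exact (hb.imp_le_hom hb').trans this

theorem isIdeal_cotensor (ht : t.ImpLeftContinuous) {X : RCat.{u} t} (hX : FinCocomplete X)
    {φ : Weight X} (hφ : IsIdeal φ) (s : unitInterval) : IsIdeal (φ.cotensor s) := by
  refine isIdeal_of_apply hX (fun b hb => ?_) (fun x y b hb => ?_) (fun c x b hb hc => ?_)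
  · exact t.imp_eq_one.2 (le_top.trans (hφ.apply_init hb).ge)
  · change t.imp s (φ x) ⊓ t.imp s (φ y) ≤ t.imp s (φ b)
    rw [← (t.gc s).u_inf]
    exact t.imp_mono le_rfl (hφ.apply_join hb)
  · change t.imp s (φ b) = 1
    rw [t.imp_eq_one]
    change c < t.imp s (φ x) at hc
    have hle : t.mul s c ≤ φ x := t.mul_le_iff.2 hc.le
    rcases hle.lt_or_eq with hlt | heq
    -- Here `d = s & c` lies strictly below `φ x`, and `s ≤ c → (s & c)`.
    · refine le_trans (t.mul_le_iff.1 ?_) (hφ.imp_le_apply_tensor hX hb hlt)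
      rw [t.comm]
    · rcases eq_or_lt_of_le (show 0 ≤ φ x from bot_le) with h0 | h0
      -- No `d` lies below `φ x = 0`; the initial object, where `φ` is 1, takes over the role of `d
      -- ⊗ x`.
      · obtain ⟨b₀, hb₀⟩ := hX.init
        have h1 := φ.mul_le b b₀
        rw [hφ.apply_init hb₀, t.one_mul, hb b₀] at h1
        refine le_trans (le_trans (t.mul_le_iff.1 ?_) (t.imp_mono le_rfl bot_le)) h1
        rw [t.comm, heq, ← h0]
        exact le_rfl
      · rcases lt_or_ge (φ x) s with hs | hs
        -- Left continuity excludes this case: from `c < s → φ x` it yields `s & c ≤ p < φ x`,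
        -- against `s & c = φ x`.
        · obtain ⟨p, hp, hcp⟩ := ht s (φ x) c h0 hs hc
          exact absurd ((heq.symm.le.trans (t.mul_le_iff.2 hcp)).trans_lt hp) (lt_irrefl _)
        · refine hs.trans (le_of_forall_lt fun d hd => ?_)
          obtain ⟨d', hdd', hd'⟩ := exists_between hd
          exact hdd'.trans_le ((t.le_imp c d').trans (hφ.imp_le_apply_tensor hX hb hd'))

/-- Under the continuity assumption, ideals of a finitely cocomplete category are closed under
weighted limits in `𝒫X`. -/
theorem isIdeal_inf_cotensor (ht : t.ImpLeftContinuous) {X : RCat.{u} t} (hX : FinCocomplete X)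
    {ι : Type v} (s : ι → unitInterval) {φ : ι → Weight X} (hφ : ∀ i, IsIdeal (φ i)) :
    IsIdeal (Weight.inf fun i => (φ i).cotensor (s i)) :=
  isIdeal_inf hX fun i => isIdeal_cotensor ht hX (hφ i) (s i)

/-- The reflection of weights into ideals. -/
def idealClosure (ht : t.ImpLeftContinuous) {X : RCat.{u} t} (hX : FinCocomplete X)
    (φ : Weight X) : (ideals t).obj X :=
  ⟨Weight.inf fun κ : (ideals t).obj X => κ.1.cotensor (sub t φ κ.1),
    isIdeal_inf_cotensor ht hX _ fun κ => κ.2⟩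

theorem le_idealClosure (ht : t.ImpLeftContinuous) {X : RCat.{u} t} (hX : FinCocomplete X)
    (φ : Weight X) (x : X) : φ x ≤ (idealClosure ht hX φ).1 x :=
  le_iInf fun κ => t.mul_le_iff.1 (by rw [t.comm]; exact mul_sub_le φ.toFun κ.1.toFun x)

theorem sub_idealClosure (ht : t.ImpLeftContinuous) {X : RCat.{u} t} (hX : FinCocomplete X)
    (φ : Weight X) (κ : (ideals t).obj X) :
    sub t (idealClosure ht hX φ).1 κ.1 = sub t φ κ.1 := by
  refine le_antisymm (iInf_mono fun x => t.imp_mono (le_idealClosure ht hX φ x) le_rfl)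
    (le_sub.2 fun x => ?_)
  rw [t.comm, t.mul_le_iff]
  exact iInf_le (fun κ : (ideals t).obj X => t.imp (sub t φ κ.1) (κ.1 x)) κ

/-- The reflection of weights into ideals as a functor. -/
def idealClosureFunctor (ht : t.ImpLeftContinuous) {X : RCat.{u} t} (hX : FinCocomplete X) :
    RFunctor (presheaf X) ((ideals t).obj X) where
  toFun φ := idealClosure ht hX φ
  hom_le φ ψ := by
    change _ ≤ sub t (idealClosure ht hX φ).1 (idealClosure ht hX ψ).1
    rw [sub_idealClosure]
    exact iInf_mono fun x => t.imp_mono le_rfl (le_idealClosure ht hX ψ x)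

theorem isRightAdjoint_incl (ht : t.ImpLeftContinuous) {X : RCat.{u} t} (hX : FinCocomplete X) :
    IsRightAdjoint ((ideals t).incl X) :=
  ⟨idealClosureFunctor ht hX, fun φ κ => sub_idealClosure ht hX φ κ⟩


/-- Isomorphic objects are equal. -/
def IsSeparated (X : RCat.{u} t) : Prop :=
  ∀ x y : X, X.hom x y = 1 → X.hom y x = 1 → x = y

theorem IsSeparated.eq_of_hom {X : RCat.{u} t} (hX : IsSeparated X) {x y : X}
    (h : ∀ z, X.hom x z = X.hom y z) : x = y :=
  hX x y ((h y).trans (X.hom_self y)) ((h x).symm.trans (X.hom_self x))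

theorem IsSeparated.eq_of_hom' {X : RCat.{u} t} (hX : IsSeparated X) {x y : X}
    (h : ∀ z, X.hom z x = X.hom z y) : x = y :=
  hX x y ((h x).symm.trans (X.hom_self x)) ((h y).trans (X.hom_self y))

/-! ### Algebras of the copresheaf monad -/

section Retraction

variable {X : RCat.{u} t} (r : RFunctor (copresheaf X) X) (hr : ∀ x, r (coyoneda X x) = x)

include hr

/-- The hom from `ψ` to the representable coweight at `z` is `ψ z`, and the retraction cannot
decrease it. -/
theorem le_hom_of_retraction (ψ : Coweight X) (z : X) : ψ z ≤ X.hom (r ψ) z := by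
  have h := r.hom_le ψ (coyoneda X z)
  rwa [hr, hom_coyoneda] at h

/-- A retraction of the coYoneda embedding computes limits. -/
theorem isLim_of_retraction (ψ : Coweight X) : IsLim ψ (r ψ) := by
  intro x
  refine le_antisymm (le_sub.2 fun z => ?_) ?_
  · exact (t.mul_mono (le_hom_of_retraction r hr ψ z) le_rfl).trans (X.hom_trans _ _ _)
  · have h := r.hom_le (coyoneda X x) ψ
    rwa [hr] at h

/-- An object representing maps out, as colimits do, is the limit of the coweight it should
represent: here 1, `X(x, -) ⊓ X(y, -)` and `s → X(x, -)`. -/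
theorem finCocomplete_of_retraction : FinCocomplete X := by
  refine ⟨⟨r ⟨fun _ => 1, fun _ _ => le_top⟩, fun w => ?_⟩, fun x y => ?_, fun s x => ?_⟩
  · exact le_antisymm le_top
      (le_hom_of_retraction r hr ⟨fun _ => 1, fun _ _ => le_top⟩ w)
  · let ψ : Coweight X := ⟨fun z => X.hom x z ⊓ X.hom y z, fun z z' =>
      le_inf ((t.mono _ _ _ inf_le_left).trans (X.hom_trans _ _ _))
        ((t.mono _ _ _ inf_le_right).trans (X.hom_trans _ _ _))⟩
    have hx : X.hom x (r ψ) = 1 := by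
      rw [isLim_of_retraction r hr ψ x]; exact sub_eq_one.2 fun z => inf_le_left
    have hy : X.hom y (r ψ) = 1 := by
      rw [isLim_of_retraction r hr ψ y]; exact sub_eq_one.2 fun z => inf_le_right
    refine ⟨r ψ, fun w => le_antisymm (le_inf ?_ ?_) (le_hom_of_retraction r hr ψ w)⟩
    · have := X.hom_trans x (r ψ) w
      rwa [hx, t.mul_one] at this
    · have := X.hom_trans y (r ψ) w
      rwa [hy, t.mul_one] at this
  · let ψ : Coweight X := ⟨fun z => t.imp s (X.hom x z), fun z z' => by
      rw [t.comm, ← t.mul_le_iff, ← t.assoc]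
      exact (t.mul_mono (t.mul_imp_le _ _) le_rfl).trans (X.hom_mul_le _ _ _)⟩
    have hx : s ≤ X.hom x (r ψ) := by
      rw [isLim_of_retraction r hr ψ x]
      refine le_sub.2 fun z => ?_
      rw [t.comm]; exact t.mul_imp_le _ _
    refine ⟨r ψ, fun w => le_antisymm ?_ (le_hom_of_retraction r hr ψ w)⟩
    rw [← t.mul_le_iff]
    exact (t.mul_mono hx le_rfl).trans (X.hom_mul_le _ _ _)

/-- A retraction of the coYoneda embedding of a separated category is an algebra structure. -/
def algebraOfRetraction (hX : IsSeparated X) : (copresheafMonad.{u} t).Algebra where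
  A := X
  a := r
  unit := RFunctor.ext (funext hr)
  assoc := RFunctor.ext (funext fun (Ψ : Coweight (copresheaf X)) => by
    change r (copresheafMult X Ψ) = r (copresheafMap r Ψ)
    refine hX.eq_of_hom' fun x => ?_
    rw [isLim_of_retraction r hr, isLim_of_retraction r hr]
    refine eq_of_forall_le_iff fun c => ?_
    refine le_sub.trans (Iff.trans ?_ le_sub.symm)
    constructor
    · intro h z
      change t.mul (⨆ ψ, t.mul (X.hom (r ψ) z) (Ψ ψ)) c ≤ X.hom x z
      rw [t.iSup_mul]
      refine iSup_le fun ψ => ?_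
      rw [t.assoc]
      refine (t.mono _ _ _ ?_).trans (X.hom_trans x (r ψ) z)
      rw [isLim_of_retraction r hr ψ x]
      refine le_sub.2 fun w => ?_
      rw [← t.assoc]
      refine (t.mul_mono ?_ le_rfl).trans (h w)
      rw [← hom_coyoneda]
      exact Ψ.mul_le ψ (coyoneda X w)
    · intro h z
      refine (t.mul_mono ?_ le_rfl).trans (h z)
      refine le_trans ?_ (le_iSup (fun ψ => t.mul (X.hom (r ψ) z) (Ψ ψ)) (coyoneda X z))
      rw [hr, X.hom_self, t.one_mul]
      exact le_rfl)

end Retraction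

theorem algebra_retraction (A : (copresheafMonad.{u} t).Algebra) (x : A.A) :
    RFunctor.toFun A.a (coyoneda A.A x) = x :=
  congrFun (congrArg RFunctor.toFun A.unit) x

theorem finCocomplete_algebra (A : (copresheafMonad.{u} t).Algebra) : FinCocomplete A.A :=
  finCocomplete_of_retraction A.a (algebra_retraction A)

theorem finCocomplete_copresheaf (X : RCat.{u} t) : FinCocomplete (copresheaf X) :=
  finCocomplete_algebra ((copresheafMonad.{u} t).free.obj X)

/-! ### Closure of ideals under cotensors -/

/-- The reflection of `s → φ` is above it by the unit, and below it because the inclusion degree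
into the ideal `φ`, which is at least `s`, is unchanged by reflection. -/
theorem isIdeal_cotensor_of_isRightAdjoint {X : RCat.{u} t}
    (h : IsRightAdjoint ((ideals t).incl X)) {φ : Weight X} (hφ : IsIdeal φ) (s : unitInterval) :
    IsIdeal (φ.cotensor s) := by
  obtain ⟨l, hl⟩ := h
  have hl' : ∀ (ψ : Weight X) (κ : (ideals t).obj X), sub t (l ψ).1 κ.1 = sub t ψ κ.1 := hl
  have h1 : ∀ x, φ.cotensor s x ≤ (l (φ.cotensor s)).1 x :=
    sub_eq_one.1 ((hl' _ _).symm.trans (sub_self _))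
  have h2 : s ≤ sub t (l (φ.cotensor s)).1 φ := by
    rw [hl' _ ⟨φ, hφ⟩]
    refine le_sub.2 fun x => ?_
    rw [t.comm]; exact t.mul_imp_le _ _
  have h3 : l (φ.cotensor s) = (φ.cotensor s) := by
    refine Weight.ext (funext fun x => le_antisymm (t.mul_le_iff.1 ?_) (h1 x))
    rw [t.comm]
    exact (t.mono _ _ _ h2).trans (mul_sub_le _ _ x)
  rw [← h3]
  exact (l (φ.cotensor s)).2

/-- The retraction computes limits in `ℐX`. Evaluation at `x` is the hom from the representable at
`x`, so the limit of the coweight `s & sub(φ, -)` can only be `s → φ`. -/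
theorem isIdeal_cotensor_of_retraction {X : RCat.{u} t}
    (r : RFunctor (copresheaf ((ideals t).obj X)) ((ideals t).obj X))
    (hr : ∀ κ, r (coyoneda ((ideals t).obj X) κ) = κ) {φ : Weight X} (hφ : IsIdeal φ)
    (s : unitInterval) : IsIdeal (φ.cotensor s) := by
  let Ψ : Coweight ((ideals t).obj X) := ⟨fun κ => t.mul s (sub t φ κ.1), fun κ κ' => by
    rw [← t.assoc, t.comm _ s, t.assoc]
    exact t.mono _ _ _ (sub_trans φ.toFun κ.1.toFun κ'.1.toFun)⟩
  have h : (r Ψ).1 = φ.cotensor s := by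
    refine Weight.ext (funext fun x => ?_)
    rw [← (ideals t).hom_yoneda X x, isLim_of_retraction r hr Ψ]
    refine eq_of_forall_le_iff fun c => ?_
    refine le_sub.trans ?_
    change (∀ κ : (ideals t).obj X, t.mul (t.mul s (sub t φ κ.1)) c ≤
      sub t (yonedaWeight X x) κ.1) ↔ c ≤ t.imp s (φ x)
    rw [← t.mul_le_iff]
    constructor
    · intro h
      have := h ⟨φ, hφ⟩
      rwa [sub_self, t.mul_one, sub_yoneda] at this
    · intro h κ
      rw [sub_yoneda]
      refine le_trans ?_ (mul_sub_le (t := t) φ.toFun κ.1.toFun x)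
      rw [show t.mul (t.mul s (sub t φ κ.1)) c = t.mul (t.mul s c) (sub t φ κ.1) by ac_rfl]
      exact t.mul_mono h le_rfl
  rw [← h]
  exact (r Ψ).2

/-- The unit law for `𝒫†` and naturality of nothing more than `ℐ a` suffice: `δ` followed by `ℐ a`
splits the coYoneda embedding of `ℐA`. -/
theorem isIdeal_cotensor_of_distributes (A : (copresheafMonad.{u} t).Algebra)
    (h : Distributes (copresheafMonad.{u} t) (idealMonad.{u} t)) {φ : Weight A.A}
    (hφ : IsIdeal φ) (s : unitInterval) : IsIdeal (φ.cotensor s) := by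
  obtain ⟨δ⟩ := h
  have hδ := δ.unit_left A.A
  refine isIdeal_cotensor_of_retraction
    (δ.law.app A.A ≫ (idealMonad.{u} t).map A.a) (fun κ => ?_) hφ s
  have h1 : (copresheafMonad.{u} t).η.app ((idealMonad.{u} t).obj A.A) ≫
      δ.law.app A.A ≫ (idealMonad.{u} t).map A.a = 𝟙 _ := by
    rw [← Category.assoc, hδ, ← Functor.map_comp, A.unit]
    exact (idealMonad.{u} t).toFunctor.map_id _
  exact congrFun (congrArg RFunctor.toFun h1) κ

/-! ### Completely distributive categories are domains -/

theorem isSeparated_of_isAlgebra {X : RCat.{u} t} (h : (allWeights.{u} t).IsAlgebra X) :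
    IsSeparated X := by
  obtain ⟨A, rfl⟩ := h
  intro x y hxy hyx
  have hA : ∀ z : A.A, RFunctor.toFun A.a ((allWeights t).yoneda A.A z) = z := fun z =>
    congrFun (congrArg RFunctor.toFun A.unit) z
  rw [← hA x, ← hA y]
  congr 1
  refine Subtype.ext (Weight.ext (funext fun z => ?_))
  change A.A.hom z x = A.A.hom z y
  have h1 := A.A.hom_trans z x y
  have h2 := A.A.hom_trans z y x
  rw [hxy, t.one_mul] at h1
  rw [hyx, t.one_mul] at h2
  exact le_antisymm h1 h2

theorem isColim_of_adj {X : RCat.{u} t} {colim : RFunctor ((allWeights.{u} t).obj X) X}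
    (h : Adj colim ((allWeights t).yoneda X)) (φ : Weight X) : IsColim φ (colim ⟨φ, trivial⟩) :=
  fun x => h ⟨φ, trivial⟩ x

theorem finCocomplete_of_isColim {X : RCat.{u} t} (h : ∀ φ : Weight X, ∃ b, IsColim φ b) :
    FinCocomplete X := by
  refine ⟨?_, fun x y => ?_, fun r x => ?_⟩
  · obtain ⟨b, hb⟩ := h (Weight.const X 0)
    exact ⟨b, fun w => (hb w).trans (sub_eq_one.2 fun z => bot_le)⟩
  · obtain ⟨b, hb⟩ := h ((yonedaWeight X x).max (yonedaWeight X y))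
    refine ⟨b, fun w => (hb w).trans (eq_of_forall_le_iff fun c => ?_)⟩
    rw [← show sub t (yonedaWeight X x) (yonedaWeight X w) = X.hom x w from sub_yoneda _ _,
      ← show sub t (yonedaWeight X y) (yonedaWeight X w) = X.hom y w from sub_yoneda _ _,
      le_inf_iff, le_sub, le_sub, le_sub, ← forall_and]
    refine forall_congr' fun z => ?_
    change t.mul (yonedaWeight X x z ⊔ yonedaWeight X y z) c ≤ _ ↔ _
    rw [t.comm, (t.gc c).l_sup, sup_le_iff, t.comm c, t.comm c]
  · obtain ⟨b, hb⟩ := h ((yonedaWeight X x).tensor r)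
    refine ⟨b, fun w => (hb w).trans (eq_of_forall_le_iff fun c => ?_)⟩
    rw [← show sub t (yonedaWeight X x) (yonedaWeight X w) = X.hom x w from sub_yoneda _ _,
      ← t.mul_le_iff, le_sub, le_sub]
    refine forall_congr' fun z => ?_
    change t.mul (t.mul r (yonedaWeight X x z)) c ≤ _ ↔ _
    rw [show t.mul (t.mul r (yonedaWeight X x z)) c = t.mul (yonedaWeight X x z) (t.mul r c) by
      ac_rfl]

/-- The weight generated by a net. -/
def netWeight (X : RCat.{u} t) {D : Type v} [Preorder D] (x : D → X) : Weight X where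
  toFun z := ⨆ i : D, ⨅ (j : D) (_ : i ≤ j), X.hom z (x j)
  mul_le y z := by
    rw [t.iSup_mul]
    refine iSup_mono fun i => le_iInf₂ fun j hj => ?_
    refine (t.mul_mono (iInf₂_le j hj) le_rfl).trans ?_
    exact X.hom_trans y z (x j)

theorem sub_netWeight {X : RCat.{u} t} {D : Type v} [Preorder D] [IsDirectedOrder D]
    {x : D → X} (hx : IsForwardCauchy x) (ψ : Weight X) :
    sub t (netWeight X x) ψ = ⨆ i : D, ⨅ (j : D) (_ : i ≤ j), ψ (x j) := by
  refine le_antisymm ?_ (iSup_le fun i => le_sub.2 fun z => ?_)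
  -- The factor 1 is replaced by the Cauchy supremum, whose `i`-th term is a lower bound for the net
  -- weight at every `x j` with `i ≤ j`.
  · rw [← t.one_mul (sub t _ _), ← hx, t.iSup_mul]
    refine iSup_mono fun i => le_iInf₂ fun j hj => ?_
    refine le_trans (t.mul_mono ?_ le_rfl) (mul_sub_le (netWeight X x).toFun ψ.toFun (x j))
    exact (iInf₂_le j hj).trans (le_iSup (fun i : D => ⨅ (k : D) (_ : i ≤ k), X.hom (x j) (x k)) j)
  · change t.mul (⨆ i : D, ⨅ (j : D) (_ : i ≤ j), X.hom z (x j)) _ ≤ _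
    rw [t.iSup_mul]
    refine iSup_le fun i' => ?_
    obtain ⟨k, hk, hk'⟩ := exists_ge_ge i i'
    refine (t.mul_mono (iInf₂_le k hk') (iInf₂_le k hk)).trans ?_
    rw [t.comm]; exact ψ.mul_le z (x k)

theorem isYonedaComplete_of_isColim {X : RCat.{u} t} (hX : IsSeparated X)
    (h : ∀ φ : Weight X, ∃ b, IsColim φ b) : IsYonedaComplete X := by
  intro D _ _ _ x hx
  obtain ⟨b, hb⟩ := h (netWeight X x)
  refine ⟨b, fun y => (hb y).trans (sub_netWeight hx _), fun b' hb' => hX.eq_of_hom fun y => ?_⟩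
  exact (hb' y).trans ((hb y).trans (sub_netWeight hx _)).symm

/-- All weights have colimits, so `𝒥X` consists of all ideals. Reflecting `d x` into ideals does not
change its homs into ideals, which leaves the adjunction intact. -/
theorem isRealEnrichedDomain_of_adj (ht : t.ImpLeftContinuous) {X : RCat.{u} t}
    (hX : IsSeparated X) {d : RFunctor X ((allWeights.{u} t).obj X)}
    {colim : RFunctor ((allWeights.{u} t).obj X) X} (hd : Adj d colim)
    (hc : Adj colim ((allWeights t).yoneda X)) : IsRealEnrichedDomain X := by
  have hcol : ∀ φ : Weight X, ∃ b, IsColim φ b := fun φ => ⟨_, isColim_of_adj hc φ⟩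
  have hfin := finCocomplete_of_isColim hcol
  refine ⟨isYonedaComplete_of_isColim hX hcol,
    ⟨fun x => ⟨(idealClosure ht hfin (d x).1).1, (idealClosure ht hfin (d x).1).2, hcol _⟩,
      fun x y => (d.hom_le x y).trans ((idealClosureFunctor ht hfin).hom_le (d x).1 (d y).1)⟩,
    ⟨fun φ => colim ⟨φ.1, trivial⟩, fun φ ψ => colim.hom_le ⟨φ.1, trivial⟩ ⟨ψ.1, trivial⟩⟩,
    fun x φ => ?_, fun φ x => hc ⟨φ.1, trivial⟩ x⟩
  exact (sub_idealClosure ht hfin (d x).1 ⟨φ.1, φ.2.1⟩).trans (hd x ⟨φ.1, trivial⟩)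

theorem isRealEnrichedDomain_of_isCompletelyDistributive (ht : t.ImpLeftContinuous)
    {X : RCat.{u} t} (hX : IsCompletelyDistributive X) : IsRealEnrichedDomain X := by
  obtain ⟨hA, d, colim, hd, hc⟩ := hX
  exact isRealEnrichedDomain_of_adj ht (isSeparated_of_isAlgebra hA) hd hc


/-! ### Categories isomorphic to `V` -/

section Unit

variable {X : RCat.{u} t} (e : X ≃ unitInterval) (he : ∀ x y, X.hom x y = t.imp (e x) (e y))

include he

theorem isSeparated_of_equiv : IsSeparated X := fun x y hxy hyx => by
  rw [he, t.imp_eq_one] at hxy hyx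
  exact e.injective (le_antisymm hxy hyx)

theorem hom_symm_one (x : X) : X.hom (e.symm 1) x = e x := by
  rw [he, e.apply_symm_apply, t.one_imp]

/-- The weight inequality against the object 1 reads `φ z & e z ≤ φ(1)`; thus the value at 1 decides
everything and is the colimit. -/
theorem sub_yonedaWeight_of_equiv (φ : Weight X) (w : X) :
    sub t φ (yonedaWeight X w) = t.imp (φ (e.symm 1)) (e w) := by
  refine le_antisymm ?_ (le_sub.2 fun z => ?_)
  · rw [← t.mul_le_iff, ← hom_symm_one e he w]
    exact mul_sub_le φ.toFun (yonedaWeight X w).toFun (e.symm 1)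
  · have h := φ.mul_le (e.symm 1) z
    rw [hom_symm_one e he] at h
    change _ ≤ X.hom z w
    rw [he, ← t.mul_le_iff, ← t.assoc, t.comm (e z)]
    exact (t.mul_mono h le_rfl).trans (t.mul_imp_le _ _)

theorem isColim_of_equiv (φ : Weight X) : IsColim φ (e.symm (φ (e.symm 1))) := fun w => by
  rw [he, e.apply_symm_apply]
  exact (sub_yonedaWeight_of_equiv e he φ w).symm

/-- The weight of all elements strictly below `y`. -/
def strictWeight (y : unitInterval) : Weight X where
  toFun z := ⨆ y' : Set.Iio y, t.imp (e z) y'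
  mul_le x z := by
    rw [t.iSup_mul]
    refine iSup_mono fun y' => ?_
    rw [he]
    exact t.imp_trans _ _ _

theorem strictWeight_one (y : unitInterval) :
    strictWeight e he y (e.symm 1) = y := by
  change (⨆ y' : Set.Iio y, t.imp (e (e.symm 1)) y') = y
  simp only [e.apply_symm_apply, t.one_imp]
  refine le_antisymm (iSup_le fun y' => y'.2.le) (le_of_forall_lt fun c hc => ?_)
  obtain ⟨c', hcc', hc'⟩ := exists_between hc
  exact hcc'.trans_le (le_iSup (fun y' : Set.Iio y => (y' : unitInterval)) ⟨c', hc'⟩)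

/-- Positivity of `y` makes the directed family of representables at `y' < y` nonempty. -/
theorem isIdeal_strictWeight {y : unitInterval} (hy : 0 < y) :
    IsIdeal (strictWeight e he y) := by
  have : Nonempty (Set.Iio y) := ⟨⟨0, hy⟩⟩
  refine isIdeal_of_directed (fun y' : Set.Iio y => e.symm y') (fun a b => ⟨a ⊔ b, ?_, ?_⟩)
    fun z => ?_
  · rw [he, e.apply_symm_apply, e.apply_symm_apply, t.imp_eq_one]
    exact (le_sup_left : a ≤ a ⊔ b)
  · rw [he, e.apply_symm_apply, e.apply_symm_apply, t.imp_eq_one]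
    exact (le_sup_right : b ≤ a ⊔ b)
  · simp only [he, e.apply_symm_apply]
    rfl

/-- In `V` the object `z` is the tensor of the scalar `z` with the object 1. -/
theorem IsIdeal.eq_one_of_lt {φ : Weight X} (hφ : IsIdeal φ) {z : unitInterval}
    (hz : z < φ (e.symm 1)) : φ (e.symm z) = 1 := by
  refine hφ.apply_tensor (c := z) (x := e.symm 1) (fun w => ?_) hz
  rw [hom_symm_one e he, he, e.apply_symm_apply]

theorem imp_le_iSup_of_cotensor
    (h : ∀ φ : Weight X, IsIdeal φ → ∀ s, IsIdeal (φ.cotensor s)) {x y z : unitInterval}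
    (hy : 0 < y) (hz : z < x) : t.imp x y ≤ ⨆ y' : Set.Iio y, t.imp z y' := by
  -- The scalar `x → y` is chosen so that the cotensor has value `(x → y) → y ≥ x > z` at 1.
  have h1 := (h _ (isIdeal_strictWeight e he hy) (t.imp x y)).eq_one_of_lt e he (z := z) (by
    change z < t.imp (t.imp x y) (strictWeight e he y (e.symm 1))
    rw [strictWeight_one]
    refine hz.trans_le (t.mul_le_iff.1 ?_)
    rw [t.comm]; exact t.mul_imp_le _ _)
  have h2 : t.imp x y ≤ strictWeight e he y (e.symm z) := t.imp_eq_one.1 h1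
  change _ ≤ ⨆ y' : Set.Iio y, t.imp (e (e.symm z)) y' at h2
  rwa [e.apply_symm_apply] at h2

/-- The ideal `d x` has colimit at least `x`, so it equals 1 at `z < x`. Its hom into the strict
ideal of `y` is `x → y`, and evaluation at `z` bounds that hom. -/
theorem imp_le_iSup_of_isContinuousCat (h : IsContinuousCat X) {x y z : unitInterval}
    (hy : 0 < y) (hz : z < x) : t.imp x y ≤ ⨆ y' : Set.Iio y, t.imp z y' := by
  obtain ⟨d, colim, hd, hc⟩ := h
  have hcolim : ∀ φ : idealsWithColim X, e (colim φ) = φ.1 (e.symm 1) := fun φ => by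
    refine t.imp_left_injective fun w => ?_
    have h1 := hc φ (e.symm w)
    rw [he, e.apply_symm_apply] at h1
    refine h1.trans ((sub_yonedaWeight_of_equiv e he φ.1 _).trans ?_)
    rw [e.apply_symm_apply]
  let φ : idealsWithColim X :=
    ⟨strictWeight e he y, isIdeal_strictWeight e he hy, _, isColim_of_equiv e he _⟩
  let κ := d (e.symm x)
  have h1 : x ≤ κ.1 (e.symm 1) := by
    have := hd (e.symm x) κ
    rw [RCat.hom_self, he, hcolim, e.apply_symm_apply] at this
    exact t.imp_eq_one.1 this.symm
  have h2 : κ.1 (e.symm z) = 1 := κ.2.1.eq_one_of_lt e he (hz.trans_le h1)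
  have h3 := hd (e.symm x) φ
  rw [he, hcolim, e.apply_symm_apply, strictWeight_one] at h3
  have h4 := mul_sub_le (t := t) κ.1.toFun φ.1.toFun (e.symm z)
  rw [h2, t.one_mul] at h4
  refine (h3.symm.le.trans h4).trans ?_
  change (⨆ y' : Set.Iio y, t.imp (e (e.symm z)) y') ≤ _
  rw [e.apply_symm_apply]

/-- `d ⊣ colim ⊣ y` for categories isomorphic to `V`. -/
theorem exists_adj_of_equiv : ∃ (d : RFunctor X ((allWeights.{u} t).obj X))
    (colim : RFunctor ((allWeights.{u} t).obj X) X),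
    Adj d colim ∧ Adj colim ((allWeights t).yoneda X) := by
  refine ⟨⟨fun x => ⟨Weight.const X (e x), trivial⟩, fun x y => ?_⟩,
    ⟨fun φ => e.symm (φ.1 (e.symm 1)), fun φ ψ => ?_⟩, fun x φ => ?_, fun φ w => ?_⟩
  · rw [he]
    exact le_iInf fun z => le_rfl
  · rw [he, e.apply_symm_apply, e.apply_symm_apply]
    exact iInf_le (fun z => t.imp (φ.1 z) (ψ.1 z)) (e.symm 1)
  · rw [he, e.apply_symm_apply]
    refine le_antisymm (iInf_le (fun z => t.imp (e x) (φ.1 z)) (e.symm 1)) (le_iInf fun z => ?_)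
    -- A weight of `V` is antitone, so its least value is the one at 1.
    refine t.imp_mono le_rfl (φ.1.le_of_hom_eq_one ?_)
    rw [he, e.apply_symm_apply]
    exact t.imp_eq_one.2 le_top
  · exact isColim_of_equiv e he φ.1 w

theorem exists_retraction_of_equiv :
    ∃ r : RFunctor (copresheaf X) X, ∀ x, r (coyoneda X x) = x := by
  refine ⟨⟨fun ψ => e.symm (⨅ z, t.imp (ψ z) (e z)), fun ψ ξ => ?_⟩, fun x => ?_⟩
  · rw [he, e.apply_symm_apply, e.apply_symm_apply, ← t.mul_le_iff]
    refine le_iInf fun z => ?_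
    refine (t.mul_mono (iInf_le _ z) (iInf_le _ z)).trans (t.imp_trans _ _ _)
  · refine e.symm_apply_eq.2 (le_antisymm (iInf_le_of_le x ?_) (le_iInf fun z => ?_))
    · change t.imp (X.hom x x) (e x) ≤ e x
      rw [X.hom_self, t.one_imp]
    · change e x ≤ t.imp (X.hom x z) (e z)
      rw [he, ← t.mul_le_iff, t.comm]
      exact t.mul_imp_le _ _

end Unit

variable (t) in
/-- The one-point category. -/
def point : RCat.{u} t where
  carrier := PUnit
  hom _ _ := 1
  hom_self _ := rfl
  hom_trans _ _ _ := (t.mul_one 1).le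

variable (t) in
/-- The free cocomplete category on one point is isomorphic to `V`. -/
def weightPointEquiv : (allWeights.{u} t).obj (point t) ≃ unitInterval where
  toFun φ := φ.1 PUnit.unit
  invFun r := ⟨Weight.const _ r, trivial⟩
  left_inv _ := rfl
  right_inv _ := rfl

theorem hom_weightPoint (φ ψ : (allWeights.{u} t).obj (point t)) :
    ((allWeights.{u} t).obj (point t)).hom φ ψ
      = t.imp (weightPointEquiv t φ) (weightPointEquiv t ψ) :=
  ciInf_unique (ι := PUnit)

/-- This provides a copy of `V` in every universe; being free, it is an algebra at once. -/
theorem isCompletelyDistributive_weightPoint :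
    IsCompletelyDistributive ((allWeights.{u} t).obj (point t)) :=
  ⟨⟨(allWeights.{u} t).monad.free.obj (point t), rfl⟩,
    exists_adj_of_equiv (weightPointEquiv t) hom_weightPoint⟩

/-! ### The distributive law -/

/-- The composite `κ ∘ ψ = sup_x κ(x) & ψ(x)` of a weight and a coweight. -/
def pairing {X : RCat.{u} t} (κ : Weight X) (ψ : Coweight X) : unitInterval :=
  ⨆ x, t.mul (κ x) (ψ x)

theorem pairing_yoneda_left {X : RCat.{u} t} (a : X) (ψ : Coweight X) :
    pairing (yonedaWeight X a) ψ = ψ a := by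
  refine le_antisymm (iSup_le fun x => ψ.mul_le x a) (le_trans ?_ (le_iSup _ a))
  rw [show yonedaWeight X a a = 1 from X.hom_self a, t.one_mul]

theorem pairing_yoneda_right {X : RCat.{u} t} (κ : Weight X) (a : X) :
    pairing κ (yonedaCoweight X a) = κ a := by
  refine le_antisymm (iSup_le fun x => κ.mul_le a x) (le_trans ?_ (le_iSup _ a))
  rw [show yonedaCoweight X a a = 1 from X.hom_self a, t.mul_one]

theorem pairing_map_left {X : RCat.{u} t} {Y : RCat.{v} t} (f : RFunctor X Y) (κ : Weight X)
    (ψ : Coweight Y) : pairing (κ.map f) ψ = pairing κ (ψ.comap f) := by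
  change (⨆ y, t.mul (⨆ x, t.mul (κ x) (Y.hom y (f x))) (ψ y)) = ⨆ x, t.mul (κ x) (ψ (f x))
  simp only [t.iSup_mul, t.assoc]
  rw [iSup_comm]
  refine iSup_congr fun x => ?_
  rw [← t.mul_iSup]
  congr 1
  exact pairing_yoneda_left (f x) ψ

theorem pairing_map_right {X : RCat.{u} t} {Y : RCat.{v} t} (f : RFunctor X Y) (κ : Weight Y)
    (ψ : Coweight X) : pairing κ (ψ.map f) = pairing (κ.comap f) ψ := by
  change (⨆ y, t.mul (κ y) (⨆ x, t.mul (Y.hom (f x) y) (ψ x))) = ⨆ x, t.mul (κ (f x)) (ψ x)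
  simp only [t.mul_iSup, ← t.assoc]
  rw [iSup_comm]
  refine iSup_congr fun x => ?_
  rw [← t.iSup_mul]
  congr 1
  exact pairing_yoneda_right κ (f x)

theorem sub_coweight_map {X : RCat.{u} t} {Y : RCat.{v} t} (f : RFunctor X Y) (ψ : Coweight X)
    (γ : Coweight Y) : sub t (ψ.map f) γ = sub t ψ (γ.comap f) := by
  refine eq_of_forall_le_iff fun r => ?_
  rw [le_sub, le_sub]
  constructor
  · intro h x
    refine le_trans (t.mul_mono (le_trans ?_ (le_iSup _ x)) le_rfl) (h (f x))
    rw [Y.hom_self, t.one_mul]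
  · intro h y
    change t.mul (⨆ x, t.mul (Y.hom (f x) y) (ψ x)) r ≤ γ y
    rw [t.iSup_mul]
    refine iSup_le fun x => ?_
    rw [t.assoc]
    exact (t.mono _ _ _ (h x)).trans (γ.mul_le _ _)

theorem pairing_mul_sub_left {X : RCat.{u} t} (κ κ' : Weight X) (ψ : Coweight X) :
    t.mul (pairing κ ψ) (sub t κ κ') ≤ pairing κ' ψ := by
  change t.mul (⨆ x, t.mul (κ x) (ψ x)) _ ≤ _
  rw [t.iSup_mul]
  refine iSup_mono fun x => ?_
  rw [show t.mul (t.mul (κ x) (ψ x)) (sub t κ κ') = t.mul (t.mul (κ x) (sub t κ κ')) (ψ x) by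
    ac_rfl]
  exact t.mul_mono (mul_sub_le _ _ x) le_rfl

theorem pairing_mul_sub_right {X : RCat.{u} t} (κ : Weight X) (ψ ψ' : Coweight X) :
    t.mul (pairing κ ψ) (sub t ψ ψ') ≤ pairing κ ψ' := by
  change t.mul (⨆ x, t.mul (κ x) (ψ x)) _ ≤ _
  rw [t.iSup_mul]
  refine iSup_mono fun x => ?_
  rw [t.assoc]
  exact t.mono _ _ _ (mul_sub_le _ _ x)

/-- Pairing with a weight, as a weight of `𝒫†X`. -/
def pairingWeight {X : RCat.{u} t} (κ : Weight X) : Weight (copresheaf X) where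
  toFun ψ := pairing κ ψ
  mul_le ψ ψ' := pairing_mul_sub_right κ ψ' ψ

/-- This is the value that the unit law of `𝒫†` prescribes for the distributive law; it also shows
that pairing with an ideal is an ideal. -/
theorem map_coyoneda {X : RCat.{u} t} (κ : Weight X) :
    κ.map (coyoneda X) = pairingWeight κ := by
  refine Weight.ext (funext fun ψ => ?_)
  change (⨆ x, t.mul (κ x) ((copresheaf X).hom ψ (coyoneda X x))) = _
  exact iSup_congr fun x => congrArg _ (hom_coyoneda X x ψ)

theorem isIdeal_pairingWeight {X : RCat.{u} t} {κ : Weight X} (hκ : IsIdeal κ) :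
    IsIdeal (pairingWeight κ) := by
  rw [← map_coyoneda]; exact hκ.map _

/-- The component of the distributive law: `Ψ ↦ (ψ ↦ inf_κ (Ψ(κ) → κ ∘ ψ))`. -/
def lawApp (ht : t.ImpLeftContinuous) (X : RCat.{u} t) :
    RFunctor (copresheaf ((ideals t).obj X)) ((ideals t).obj (copresheaf X)) where
  toFun Ψ := ⟨Weight.inf fun κ : (ideals t).obj X => (pairingWeight κ.1).cotensor (Ψ κ),
    isIdeal_inf_cotensor ht (finCocomplete_copresheaf X) _ fun κ => isIdeal_pairingWeight κ.2⟩
  hom_le Ψ Ψ' := le_sub.2 fun ψ => le_iInf fun κ => by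
    refine (t.mul_mono (iInf_le _ κ) (iInf_le _ κ)).trans ?_
    exact t.imp_trans (Ψ'.toFun κ) (Ψ.toFun κ) (pairing κ.1 ψ)

section Law

variable (ht : t.ImpLeftContinuous)

theorem lawApp_apply {X : RCat.{u} t} (Ψ : Coweight ((ideals t).obj X)) (ψ : Coweight X) :
    (lawApp ht X Ψ).1 ψ = ⨅ κ : (ideals t).obj X, t.imp (Ψ κ) (pairing κ.1 ψ) := rfl

/-- Change of variables for the weighted limit: pairing is functorial in the ideal, so extending `Θ`
along `f` adds no new constraints. -/
theorem lawApp_map {Z : RCat.{v} t} {X : RCat.{u} t} (f : RFunctor Z ((ideals t).obj X))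
    (Θ : Coweight Z) (ψ : Coweight X) :
    (lawApp ht X (Θ.map f)).1 ψ = ⨅ z, t.imp (Θ z) (pairing (f z).1 ψ) := by
  rw [lawApp_apply]
  refine le_antisymm (le_iInf fun z => (iInf_le _ (f z)).trans (t.imp_mono ?_ le_rfl))
    (le_iInf fun κ => ?_)
  · refine le_trans ?_ (le_iSup _ z)
    rw [RCat.hom_self, t.one_mul]
  · change _ ≤ t.imp (⨆ z, t.mul (sub t (f z).1 κ.1) (Θ z)) _
    rw [t.imp_iSup]
    refine le_iInf fun z => (iInf_le _ z).trans ?_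
    rw [← t.mul_le_iff, t.assoc, t.comm]
    exact (t.mul_mono (t.mul_imp_le _ _) le_rfl).trans (pairing_mul_sub_left _ _ _)

theorem lawApp_coyoneda {X : RCat.{u} t} (κ : (ideals t).obj X) (ψ : Coweight X) :
    (lawApp ht X (coyoneda _ κ)).1 ψ = pairing κ.1 ψ := by
  rw [lawApp_apply]
  refine le_antisymm ((iInf_le _ κ).trans ?_) (le_iInf fun κ' => ?_)
  · change t.imp (sub t κ.1 κ.1) _ ≤ _
    rw [sub_self, t.one_imp]
  · rw [← t.mul_le_iff, t.comm]
    exact pairing_mul_sub_left _ _ _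

theorem lawApp_map_yoneda {X : RCat.{u} t} (ψ₀ ψ : Coweight X) :
    (lawApp ht X (ψ₀.map ((ideals t).yoneda X))).1 ψ = sub t ψ₀ ψ := by
  rw [lawApp_map]
  exact iInf_congr fun x => congrArg _ (pairing_yoneda_left x ψ)

theorem lawApp_naturality {X Y : RCat.{u} t} (f : RFunctor X Y)
    (Ψ : Coweight ((ideals t).obj X)) :
    lawApp ht Y (Ψ.map ((ideals t).map f))
      = (ideals t).map (copresheafMap f) (lawApp ht X Ψ) := by
  refine Subtype.ext (Weight.ext (funext fun χ => ?_))
  rw [lawApp_map]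
  change _ = ⨆ ψ, t.mul ((lawApp ht X Ψ).1 ψ) (sub t (ψ.map f) χ)
  simp only [sub_coweight_map]
  refine Eq.trans ?_ (pairing_yoneda_right (lawApp ht X Ψ).1 (χ.comap f)).symm
  exact iInf_congr fun κ => congrArg _ (pairing_map_left f κ.1 χ)

theorem lawApp_mult_left {X : RCat.{u} t} (Θ : Coweight (copresheaf ((ideals t).obj X))) :
    lawApp ht X (copresheafMult _ Θ)
      = (ideals t).map (copresheafMult X) (lawApp ht _ (copresheafMap (lawApp ht X) Θ)) := by
  refine Subtype.ext (Weight.ext (funext fun ψ => ?_))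
  let K := (lawApp ht (copresheaf X) (copresheafMap (lawApp ht X) Θ)).1
  have hK : ((ideals t).map (copresheafMult X)
      (lawApp ht _ (copresheafMap (lawApp ht X) Θ))).1 ψ = K (coyoneda _ ψ) := by
    -- Multiplication is a limit, hence right adjoint to the coYoneda embedding; the supremum
    -- collapses to evaluation at the coweight represented by `ψ`.
    refine Eq.trans (iSup_congr fun Ω => ?_) (pairing_yoneda_right K (coyoneda _ ψ))
    exact congrArg _ (isLim_copresheafMult X Ω ψ)
  rw [hK]
  refine Eq.trans ?_ (lawApp_map ht (lawApp ht X) Θ (coyoneda _ ψ)).symm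
  change (⨅ κ, t.imp (Θ (coyoneda _ κ)) (pairing κ.1 ψ)) = ⨅ Ψ, t.imp (Θ Ψ)
    (pairing (lawApp ht X Ψ).1 (yonedaCoweight (copresheaf X) ψ))
  simp only [pairing_yoneda_right]
  refine le_antisymm (le_iInf fun Ψ => ?_) (le_iInf fun κ => (iInf_le _ (coyoneda _ κ)).trans ?_)
  · rw [lawApp_apply, t.imp_iInf]
    refine le_iInf fun κ => (iInf_le _ κ).trans ?_
    rw [← t.imp_mul]
    refine t.imp_mono ?_ le_rfl
    have h := Θ.mul_le Ψ (coyoneda _ κ)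
    rwa [hom_coyoneda, t.comm] at h
  · rw [lawApp_coyoneda]

theorem lawApp_mult_right {X : RCat.{u} t}
    (Θ : Coweight ((ideals t).obj ((ideals t).obj X))) :
    lawApp ht X (copresheafMap ((ideals t).mult X) Θ)
      = (ideals t).mult _ ((ideals t).map (lawApp ht X) (lawApp ht _ Θ)) := by
  refine Subtype.ext (Weight.ext (funext fun ψ => ?_))
  have hL := lawApp_map ht ((ideals t).mult X) Θ ψ
  refine hL.trans ?_
  have hm : ∀ Φ : (ideals t).obj ((ideals t).obj X),
      pairing ((ideals t).mult X Φ).1 ψ = pairing Φ.1 (ψ.map ((ideals t).yoneda X)) :=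
    fun Φ => (pairing_map_right ((ideals t).yoneda X) Φ.1 ψ).symm
  simp only [hm]
  change _ = ⨆ Ψ, t.mul ((lawApp ht _ Θ).1 Ψ)
    (((ideals t).obj (copresheaf X)).hom ((ideals t).yoneda _ ψ) (lawApp ht X Ψ))
  refine Eq.trans ?_ (iSup_congr fun Ψ =>
    congrArg _ ((ideals t).hom_yoneda _ ψ (lawApp ht X Ψ)).symm)
  refine le_antisymm ?_ (iSup_le fun Ψ => le_iInf fun Φ => ?_)
  -- The supremum is attained at the extension of `ψ` along the Yoneda embedding, where the second
  -- factor is `sub(ψ, ψ) = 1`.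
  · refine le_trans ?_ (le_iSup _ (ψ.map ((ideals t).yoneda X)))
    rw [lawApp_map_yoneda, sub_self, t.mul_one, lawApp_apply]
  · refine (t.mul_mono (iInf_le _ Φ) le_rfl).trans ?_
    change t.mul (t.imp (Θ Φ) (pairing Φ.1 Ψ)) _ ≤ _
    rw [← t.mul_le_iff, ← t.assoc]
    refine (t.mul_mono (t.mul_imp_le _ _) le_rfl).trans ?_
    change t.mul (⨆ κ, t.mul (Φ.1 κ) (Ψ κ)) _ ≤ _
    rw [t.iSup_mul]
    refine iSup_mono fun κ => ?_
    rw [t.assoc]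
    refine t.mono _ _ _ ((t.mono _ _ _ (iInf_le _ κ)).trans ((t.mul_imp_le _ _).trans ?_))
    change pairing κ.1 ψ ≤ ⨆ x, t.mul (sub t (yonedaWeight X x) κ.1) (ψ x)
    simp only [sub_yoneda]
    exact le_rfl

/-- Under the continuity assumption, the copresheaf monad distributes over the ideal monad. -/
def distributiveLaw : DistributiveLaw (copresheafMonad.{u} t) (idealMonad.{u} t) where
  law := {
    app := fun X => lawApp ht X
    naturality := fun _ _ f => RFunctor.ext (funext fun Ψ => lawApp_naturality ht f Ψ) }
  unit_left X := RFunctor.ext (funext fun (κ : (ideals t).obj X) =>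
    Subtype.ext ((Weight.ext (funext fun ψ => lawApp_coyoneda ht κ ψ) :
      _ = pairingWeight κ.1).trans (map_coyoneda κ.1).symm))
  unit_right X := RFunctor.ext (funext fun (ψ₀ : Coweight X) =>
    Subtype.ext (Weight.ext (funext fun ψ => lawApp_map_yoneda ht ψ₀ ψ)))
  mul_left _ := RFunctor.ext (funext fun Θ => lawApp_mult_left ht Θ)
  mul_right _ := RFunctor.ext (funext fun Θ => lawApp_mult_right ht Θ)

end Law

end

end

end RealEnriched

/-! ### The equivalence, with condition 3 as the hub -/

open RealEnriched in
theorem mainTheorem3 (t : RealEnriched.ContTNorm) :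
    List.TFAE [
      ∀ X : RealEnriched.RCat.{u} t,
        RealEnriched.IsCompletelyDistributive X → RealEnriched.IsRealEnrichedDomain X,
      RealEnriched.IsRealEnrichedDomain (RealEnriched.V t),
      ∀ x y : unitInterval, x ≠ y →
        ContinuousAt (fun p : unitInterval × unitInterval => t.imp p.1 p.2) (x, y),
      ∀ A : (RealEnriched.copresheafMonad.{u} t).Algebra,
        RealEnriched.IsRightAdjoint ((RealEnriched.ideals.{u} t).incl A.A),
      RealEnriched.Distributes
        (RealEnriched.copresheafMonad.{u} t) (RealEnriched.idealMonad.{u} t)] := by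
  obtain ⟨r, hr⟩ := exists_retraction_of_equiv (weightPointEquiv.{u} t) hom_weightPoint
  -- The copy of `V`, viewed as a copresheaf algebra, is the test object for conditions 4 and 5.
  let A := algebraOfRetraction r hr
    (isSeparated_of_equiv (weightPointEquiv.{u} t) hom_weightPoint)
  tfae_have 1 → 3 := fun h x y hxy => t.continuousAt_imp_of_iSup (fun x y z hy hz =>
    imp_le_iSup_of_isContinuousCat (weightPointEquiv.{u} t) hom_weightPoint
      (h _ isCompletelyDistributive_weightPoint).2 hy hz) hxy
  tfae_have 2 → 3 := fun h x y hxy => t.continuousAt_imp_of_iSup (fun x y z hy hz =>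
    imp_le_iSup_of_isContinuousCat (X := V t) (Equiv.refl _) (fun _ _ => rfl) h.2 hy hz) hxy
  tfae_have 4 → 3 := fun h x y hxy => t.continuousAt_imp_of_iSup (fun x y z hy hz =>
    imp_le_iSup_of_cotensor (weightPointEquiv.{u} t) hom_weightPoint
      (fun φ hφ s => isIdeal_cotensor_of_isRightAdjoint (h A) hφ s) hy hz) hxy
  tfae_have 5 → 3 := fun h x y hxy => t.continuousAt_imp_of_iSup (fun x y z hy hz =>
    imp_le_iSup_of_cotensor (weightPointEquiv.{u} t) hom_weightPoint
      (fun φ hφ s => isIdeal_cotensor_of_distributes A h hφ s) hy hz) hxy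
  tfae_have 3 → 1 := fun h X hX => isRealEnrichedDomain_of_isCompletelyDistributive
    (t.impLeftContinuous_of_continuousAt h) hX
  tfae_have 3 → 2 := fun h => by
    obtain ⟨d, colim, hd, hc⟩ :=
      exists_adj_of_equiv (X := V t) (Equiv.refl _) (fun _ _ => rfl)
    exact isRealEnrichedDomain_of_adj (t.impLeftContinuous_of_continuousAt h)
      (isSeparated_of_equiv (X := V t) (Equiv.refl _) (fun _ _ => rfl)) hd hc
  tfae_have 3 → 4 := fun h A =>
    isRightAdjoint_incl (t.impLeftContinuous_of_continuousAt h) (finCocomplete_algebra A)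
  tfae_have 3 → 5 := fun h => ⟨distributiveLaw (t.impLeftContinuous_of_continuousAt h)⟩
  tfae_finish
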